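/- Let $N=\begin{pmatrix}0&1&0\\0&0&1\\0&0&0\end{pmatrix}$, $J=I+N$, $\hat e_3=(0,0,1)^T$, and write $\xi=(x,y,z)^T\in\mathbb{R}^3$. A differentiable map $F:\mathbb{R}^3\to\mathbb{R}^3$ is called volume-preserving if $\det DF(\xi)=1$ for all $\xi$. For a formal power series $p\in\mathbb{R}[[x,y]]$ without terms of degree $0$ and $1$, consider the formal map $$g(\xi)=J\bigl(\xi+\hat e_3\,p(x,y)\bigr),$$ and for $d\ge 1$ let $g_d(\xi)=J(\xi+\hat e_3\,p_{\le d}(x,y))$ be its truncation at degree $d$, where $p_{\le d}$ is the sum of the terms of $p$ of total degree at most $d$. (a) Let $f:\mathbb{R}^3\to\mathbb{R}^3$ be a $C^\infty$ volume-preserving diffeomorphism with $f(0)=0$ and $Df(0)=J$. Then there is a formal power series $p$ in two variables without terms of degree $0$ and $1$ such that for every $d\ge 1$ there is a $C^\infty$ volume-preserving diffeomorphism $\psi:\mathbb{R}^3\to\mathbb{R}^3$ that is near-identity, i.e. $\psi(\xi)=\xi+O(|\xi|^2)$ as $\xi\to 0$, and satisfies $$\psi(f(\xi))=g_d(\psi(\xi))+O(|\xi|^{d+1})\qquad(\xi\to0).$$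 (b) For every formal power series $p$ in two variables without terms of degree $0$ and $1$, and every $d\ge1$, the truncation $g_d$ is exactly volume-preserving on all of $\mathbb{R}^3$, and it is a bijection of $\mathbb{R}^3$ whose inverse is a polynomial map of the same degree as $g_d$ (the degree of a polynomial map being the largest total degree of its components). -/

import Mathlib

open scoped Manifold ContDiff Topology

/-- Euclidean three-space, with coordinates `ξ 0 = x`, `ξ 1 = y`, `ξ 2 = z`. -/
abbrev E3 : Type := EuclideanSpace ℝ (Fin 3)

/-- The nilpotent Jordan block `N`. -/
def jordanN : Matrix (Fin 3) (Fin 3) ℝ := !![0, 1, 0; 0, 0, 1; 0, 0, 0]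

/-- The unipotent Jordan block `J = I + N`. -/
def jordanJ : Matrix (Fin 3) (Fin 3) ℝ := 1 + jordanN

/-- A differentiable map of `ℝ³` is volume-preserving when its Jacobian determinant is
one at every point. -/
def IsVolumePreserving (f : E3 → E3) : Prop :=
  Differentiable ℝ f ∧ ∀ ξ, (fderiv ℝ f ξ).det = 1

/-- `ψ(ξ) = ξ + h(ξ)` with `h = O(2)`, i.e. `h` starts with quadratic terms. -/
def IsNearIdentity (ψ : E3 → E3) : Prop :=
  (fun ξ => ψ ξ - ξ) =O[𝓝 0] (fun ξ => ‖ξ‖ ^ 2)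

/-- A polynomial self-map of `ℝ³`, given by its three component polynomials. -/
abbrev PolyMap : Type := Fin 3 → MvPolynomial (Fin 3) ℝ

namespace PolyMap

/-- The map `ℝ³ → ℝ³` given by a triple of polynomials. -/
noncomputable def toFun (G : PolyMap) (ξ : E3) : E3 :=
  WithLp.toLp 2 fun i => MvPolynomial.eval (fun j => ξ j) (G i)

/-- The degree of a polynomial map: the largest total degree of its components. -/
noncomputable def degree (G : PolyMap) : ℕ :=
  Finset.univ.sup fun i => (G i).totalDegree

end PolyMap

/-- The polynomial map `ξ ↦ J (ξ + ê₃ q(x, y))` for a polynomial `q` in two variables. -/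
noncomputable def shearMap (q : MvPolynomial (Fin 2) ℝ) : PolyMap := fun i =>
  ∑ j, MvPolynomial.C (jordanJ i j) *
    (MvPolynomial.X j + if j = 2 then MvPolynomial.rename ![0, 1] q else 0)

/-- The truncation at degree `d ≥ 1` of the formal map `g(ξ) = J (ξ + ê₃ p(x, y))`, where `p`
is a formal power series in two variables: only the terms of total degree at most `d` of `p`
are kept. -/
noncomputable def normalFormTrunc (p : MvPowerSeries (Fin 2) ℝ) (d : ℕ) : PolyMap :=
  shearMap (MvPowerSeries.truncTotal (d + 1) p)

/-!
Part (a) is an induction on the degree `k`. Suppose that `f` has been conjugated to a map `F` which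
agrees with `G(ξ) = J (ξ + ê₃ q(x, y))` up to `O(‖ξ‖ ^ k)`. Then `G⁻¹ ∘ F = ξ + S + ⋯` with
`S` homogeneous of degree `k`, and expanding the Jacobian determinant shows that `S` is
divergence-free (`exists_leading_part`). Conjugating by a volume-preserving `φ = ξ + h + ⋯` removes
`S` up to a new term `r(x, y)` of the normal form exactly when
`S = h - J⁻¹ (h ∘ J) + r ê₃` and `div h = 0` (`exists_normalization_step`).

*The homological equation* (`exists_homological_solution`). Write `Δ u = u ∘ J - u` on polynomials.
The three components of the equation can be solved one after the other in terms of one free unknown,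
and what remains is to make `h` divergence-free, an equation
`∂₀ (u ∘ J) + ∂₁ Δ (u ∘ J) + ∂₂ Δ² u = w`. On the image of `Δ ^ m`, modulo the image of
`Δ ^ (m + 1)`, the left side acts as a positive multiple of `∂₀`. Since `∂₀` is onto and `Δ` is
nilpotent in each degree, the operator is onto (`exists_divergence_eq`). That `r` does not depend on
`z` comes for free, because `J⁻¹ (h ∘ J)` has divergence `(div h) ∘ J = 0`.

*Realization by global diffeomorphisms* (`isShearJet_of_divergence_eq_zero`). A shear `ξ + s(ξ) v`,
with `s` constant along `v`, is exactly volume-preserving and has inverse `ξ - s(ξ) v`. Leading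
parts add up under composition, so it suffices to write a homogeneous divergence-free field as a sum
of shear fields. Such a field is a sum of two Hamiltonian fields in two variables (the third one
being a parameter) and of a shear `c(x, y) ê₃`; by a Vandermonde argument the Hamiltonians are sums
of terms `(xᵢ + t xⱼ) ^ n xₗ ^ e`, whose Hamiltonian fields are shears.

*Taylor expansion.* The leading homogeneous term of a smooth function which is `O(‖ξ‖ ^ k)`, and the
fact that differentiating lowers such an order by one, are obtained by induction on `k` from the
partial derivatives, with Euler's identity as the integration step
(`VanishesToOrder.exists_taylor`, `VanishesToOrder.of_isBigO`).

The degree `k` term of `q` is never modified after step `k`, so that the polynomials `q` are the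
truncations of one power series (`exists_normalForm`).

For part (b), `J (ξ + ê₃ q(x, y))` is a composition of three shears, and its inverse
`(x - y + z, y - z, z - q(x - y + z, y - z))` has the same degree because substituting `J⁻¹` into a
polynomial preserves the total degree.
-/

open MvPolynomial Asymptotics Filter

/-! ### Substitution of the Jordan block in polynomials -/

theorem MvPolynomial.IsHomogeneous.degree_eq_of_mem_support {σ : Type*} {k : ℕ}
    {u : MvPolynomial σ ℝ} (hu : u.IsHomogeneous k) {s : σ →₀ ℕ} (hs : s ∈ u.support) :
    s.degree = k := by
  by_contra h
  exact mem_support_iff.1 hs (hu.coeff_eq_zero h)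

/-- Surjectivity of each partial derivative in the graded sense: integrate term by term. -/
theorem MvPolynomial.IsHomogeneous.exists_pderiv_eq {σ : Type*} (j : σ) {k : ℕ}
    {u : MvPolynomial σ ℝ} (hu : u.IsHomogeneous k) :
    ∃ U : MvPolynomial σ ℝ, U.IsHomogeneous (k + 1) ∧ pderiv j U = u := by
  classical
  refine ⟨∑ s ∈ u.support, monomial (s + Finsupp.single j 1) (coeff s u / (s j + 1 : ℝ)), ?_, ?_⟩
  · refine IsHomogeneous.sum _ _ _ fun s hs => isHomogeneous_monomial _ ?_
    simp [hu.degree_eq_of_mem_support hs]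
  · conv_rhs => rw [u.as_sum]
    rw [map_sum]
    refine Finset.sum_congr rfl fun s _ => ?_
    rw [pderiv_monomial]
    have : (s j + 1 : ℝ) ≠ 0 := by positivity
    simp [this]

/-- The substitution `u ↦ u ∘ J` on polynomials. -/
noncomputable def jordanSubst : MvPolynomial (Fin 3) ℝ →ₐ[ℝ] MvPolynomial (Fin 3) ℝ :=
  aeval ![X 0 + X 1, X 1 + X 2, X 2]

/-- The substitution `u ↦ u ∘ J⁻¹` on polynomials. -/
noncomputable def jordanSubstInv : MvPolynomial (Fin 3) ℝ →ₐ[ℝ] MvPolynomial (Fin 3) ℝ :=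
  aeval ![X 0 - X 1 + X 2, X 1 - X 2, X 2]

theorem jordanSubst_jordanSubstInv (u : MvPolynomial (Fin 3) ℝ) :
    jordanSubst (jordanSubstInv u) = u := by
  have : jordanSubst.comp jordanSubstInv = AlgHom.id ℝ _ := by
    ext i : 1
    fin_cases i
    · simp [jordanSubst, jordanSubstInv]; ring
    · simp [jordanSubst, jordanSubstInv]
    · simp [jordanSubst, jordanSubstInv]
  exact DFunLike.congr_fun this u

theorem MvPolynomial.IsHomogeneous.jordanSubst {u : MvPolynomial (Fin 3) ℝ} {k : ℕ}
    (hu : u.IsHomogeneous k) : (jordanSubst u).IsHomogeneous k := by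
  have := hu.aeval (n := 1) (S := ℝ) ![X 0 + X 1, X 1 + X 2, (X 2 : MvPolynomial (Fin 3) ℝ)] ?_
  · rwa [one_mul] at this
  · intro i
    fin_cases i
    · exact (isHomogeneous_X _ _).add (isHomogeneous_X _ _)
    · exact (isHomogeneous_X _ _).add (isHomogeneous_X _ _)
    · exact isHomogeneous_X _ _

theorem MvPolynomial.IsHomogeneous.jordanSubstInv {u : MvPolynomial (Fin 3) ℝ} {k : ℕ}
    (hu : u.IsHomogeneous k) : (jordanSubstInv u).IsHomogeneous k := by
  have := hu.aeval (n := 1) (S := ℝ)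
    ![X 0 - X 1 + X 2, X 1 - X 2, (X 2 : MvPolynomial (Fin 3) ℝ)] ?_
  · rwa [one_mul] at this
  · intro i
    fin_cases i
    · exact ((isHomogeneous_X _ _).sub (isHomogeneous_X _ _)).add (isHomogeneous_X _ _)
    · exact (isHomogeneous_X _ _).sub (isHomogeneous_X _ _)
    · exact isHomogeneous_X _ _

/-- The chain rule for the substitution `u ↦ u ∘ J`. -/
theorem pderiv_jordanSubst (u : MvPolynomial (Fin 3) ℝ) :
    pderiv 0 (jordanSubst u) = jordanSubst (pderiv 0 u) ∧
    pderiv 1 (jordanSubst u) = jordanSubst (pderiv 0 u + pderiv 1 u) ∧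
    pderiv 2 (jordanSubst u) = jordanSubst (pderiv 1 u + pderiv 2 u) := by
  induction u using MvPolynomial.induction_on with
  | C a => simp [jordanSubst]
  | add p q hp hq =>
    simp only [map_add, hp, hq]
    refine ⟨trivial, by ring, by ring⟩
  | mul_X p i hp =>
    obtain ⟨h0, h1, h2⟩ := hp
    simp only [map_mul, Derivation.leibniz, h0, h1, h2, map_add, smul_eq_mul]
    fin_cases i <;> simp [jordanSubst, pderiv_X] <;>
      refine ⟨?_, ?_⟩ <;> ring

/-- The difference operator `Δ u = u ∘ J - u` on polynomials. -/
noncomputable def jordanDiff : Module.End ℝ (MvPolynomial (Fin 3) ℝ) :=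
  jordanSubst.toLinearMap - 1

theorem jordanDiff_apply (u : MvPolynomial (Fin 3) ℝ) : jordanDiff u = jordanSubst u - u := rfl

theorem jordanSubst_eq (u : MvPolynomial (Fin 3) ℝ) : jordanSubst u = jordanDiff u + u := by
  rw [jordanDiff_apply]; ring

theorem MvPolynomial.IsHomogeneous.jordanDiff {u : MvPolynomial (Fin 3) ℝ} {k : ℕ}
    (hu : u.IsHomogeneous k) : (jordanDiff u).IsHomogeneous k :=
  hu.jordanSubst.sub hu

theorem jordanDiff_pow_succ (n : ℕ) (u : MvPolynomial (Fin 3) ℝ) :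
    (jordanDiff ^ (n + 1)) u = jordanDiff ((jordanDiff ^ n) u) := by
  rw [pow_succ', Module.End.mul_apply]

theorem jordanDiff_pow_succ' (n : ℕ) (u : MvPolynomial (Fin 3) ℝ) :
    (jordanDiff ^ (n + 1)) u = (jordanDiff ^ n) (jordanDiff u) := by
  rw [pow_succ, Module.End.mul_apply]

theorem jordanDiff_pow_jordanDiff (n : ℕ) (u : MvPolynomial (Fin 3) ℝ) :
    (jordanDiff ^ n) (jordanDiff u) = jordanDiff ((jordanDiff ^ n) u) := by
  rw [← jordanDiff_pow_succ, jordanDiff_pow_succ']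

theorem MvPolynomial.IsHomogeneous.jordanDiff_pow {u : MvPolynomial (Fin 3) ℝ} {k : ℕ}
    (hu : u.IsHomogeneous k) (n : ℕ) : ((_root_.jordanDiff ^ n) u).IsHomogeneous k := by
  induction n with
  | zero => simpa using hu
  | succ n ih => rw [jordanDiff_pow_succ]; exact ih.jordanDiff

theorem pderiv_zero_jordanDiff (u : MvPolynomial (Fin 3) ℝ) :
    pderiv 0 (jordanDiff u) = jordanDiff (pderiv 0 u) := by
  simp only [jordanDiff_apply, map_sub, (pderiv_jordanSubst u).1]

theorem pderiv_one_jordanDiff (u : MvPolynomial (Fin 3) ℝ) :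
    pderiv 1 (jordanDiff u) = jordanDiff (pderiv 1 u) + jordanDiff (pderiv 0 u) + pderiv 0 u := by
  simp only [jordanDiff_apply, map_sub, (pderiv_jordanSubst u).2.1, map_add]
  ring

theorem pderiv_two_jordanDiff (u : MvPolynomial (Fin 3) ℝ) :
    pderiv 2 (jordanDiff u) = jordanDiff (pderiv 2 u) + jordanDiff (pderiv 1 u) + pderiv 1 u := by
  simp only [jordanDiff_apply, map_sub, (pderiv_jordanSubst u).2.2, map_add]
  ring

/-- Multiplication by `X 2`, `X 1`, `X 0` raises the nilpotency index of `Δ` by at most `0`, `1`,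
`2`, because `Δ` sends these variables to `0`, `X 2`, `X 1`. -/
theorem jordanDiff_pow_mul_X {n : ℕ} {a : MvPolynomial (Fin 3) ℝ} (ha : (jordanDiff ^ n) a = 0) :
    (jordanDiff ^ n) (a * X 2) = 0 ∧ (jordanDiff ^ (n + 1)) (a * X 1) = 0 ∧
      (jordanDiff ^ (n + 2)) (a * X 0) = 0 := by
  have e2 (b : MvPolynomial (Fin 3) ℝ) : jordanDiff (b * X 2) = jordanDiff b * X 2 := by
    simp [jordanDiff_apply, jordanSubst]; ring
  have e1 (b : MvPolynomial (Fin 3) ℝ) :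
      jordanDiff (b * X 1) = jordanDiff b * X 1 + (jordanDiff b + b) * X 2 := by
    simp [jordanDiff_apply, jordanSubst]; ring
  have e0 (b : MvPolynomial (Fin 3) ℝ) :
      jordanDiff (b * X 0) = jordanDiff b * X 0 + (jordanDiff b + b) * X 1 := by
    simp [jordanDiff_apply, jordanSubst]; ring
  have f2 : ∀ n a, (jordanDiff ^ n) a = 0 → (jordanDiff ^ n) (a * X 2) = 0 := by
    intro n
    induction n with
    | zero => intro a ha; simp_all
    | succ n ih =>
      intro a ha
      rw [jordanDiff_pow_succ'] at ha ⊢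
      rw [e2]; exact ih _ ha
  have up : ∀ n a, (jordanDiff ^ n) a = 0 → (jordanDiff ^ (n + 1)) a = 0 := by
    intro n a ha
    rw [jordanDiff_pow_succ, ha, map_zero]
  have dd : ∀ n a, (jordanDiff ^ n) a = 0 → (jordanDiff ^ n) (jordanDiff a + a) = 0 := by
    intro n a ha
    rw [map_add, ha, ← jordanDiff_pow_succ', up n a ha, add_zero]
  have f1 : ∀ n a, (jordanDiff ^ n) a = 0 → (jordanDiff ^ (n + 1)) (a * X 1) = 0 := by
    intro n
    induction n with
    | zero => intro a ha; simp_all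
    | succ n ih =>
      intro a ha
      rw [jordanDiff_pow_succ', e1, map_add, f2 (n + 1) _ (dd _ _ ha),
        ih _ (by rwa [← jordanDiff_pow_succ']), add_zero]
  have f0 : ∀ n a, (jordanDiff ^ n) a = 0 → (jordanDiff ^ (n + 2)) (a * X 0) = 0 := by
    intro n
    induction n with
    | zero => intro a ha; simp_all
    | succ n ih =>
      intro a ha
      rw [jordanDiff_pow_succ', e0, map_add, f1 (n + 1) _ (dd _ _ ha),
        ih _ (by rwa [← jordanDiff_pow_succ']), add_zero]
  exact ⟨f2 n a ha, f1 n a ha, f0 n a ha⟩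

theorem jordanDiff_pow_of_le {n m : ℕ} (h : n ≤ m) {a : MvPolynomial (Fin 3) ℝ}
    (ha : (jordanDiff ^ n) a = 0) : (jordanDiff ^ m) a = 0 := by
  obtain ⟨c, rfl⟩ := Nat.exists_eq_add_of_le' h
  rw [pow_add, Module.End.mul_apply, ha, map_zero]

theorem jordanDiff_pow_monomial (s : Fin 3 →₀ ℕ) (c : ℝ) :
    (jordanDiff ^ (2 * s.degree + 1)) (monomial s c) = 0 := by
  obtain ⟨n, hn⟩ : ∃ n, s.degree = n := ⟨_, rfl⟩
  rw [hn]
  induction n generalizing s with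
  | zero =>
    obtain rfl : s = 0 := (Finsupp.degree_eq_zero_iff s).1 hn
    simp [jordanDiff_apply, jordanSubst, ← C_apply]
  | succ n ih =>
    obtain ⟨i, hi⟩ : ∃ i, s i ≠ 0 := by
      by_contra! h
      obtain rfl : s = 0 := Finsupp.ext h
      simp at hn
    have hs : s - Finsupp.single i 1 + Finsupp.single i 1 = s :=
      Finsupp.sub_add_single_one_cancel hi
    have hd : (s - Finsupp.single i 1).degree = n := by
      rw [← hs, map_add, Finsupp.degree_single] at hn
      omega
    obtain ⟨h2, h1, h0⟩ := jordanDiff_pow_mul_X (ih _ hd)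
    have e : monomial s c = monomial (s - Finsupp.single i 1) c * X i := by
      rw [X, monomial_mul, hs, mul_one]
    rw [e]
    fin_cases i
    · exact h0
    · exact jordanDiff_pow_of_le (by omega) h1
    · exact jordanDiff_pow_of_le (by omega) h2

/-- `Δ` is nilpotent on homogeneous polynomials of each degree. -/
theorem MvPolynomial.IsHomogeneous.jordanDiff_pow_eq_zero {u : MvPolynomial (Fin 3) ℝ} {k : ℕ}
    (hu : u.IsHomogeneous k) : (_root_.jordanDiff ^ (2 * k + 1)) u = 0 := by
  rw [u.as_sum, map_sum]
  refine Finset.sum_eq_zero fun s hs => ?_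
  rw [← hu.degree_eq_of_mem_support hs]
  exact jordanDiff_pow_monomial s _

/-! ### The homological equation -/

/-- Commuting `∂₁` past a power of `Δ` produces `∂₀` in leading order. -/
theorem exists_pderiv_one_jordanDiff_pow {k : ℕ} {v : MvPolynomial (Fin 3) ℝ}
    (hv : v.IsHomogeneous (k + 1)) (n : ℕ) :
    ∃ b : MvPolynomial (Fin 3) ℝ, b.IsHomogeneous k ∧
      pderiv 1 ((jordanDiff ^ (n + 1)) v) =
        (n + 1 : ℝ) • (jordanDiff ^ n) (pderiv 0 v) + (jordanDiff ^ (n + 1)) b := by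
  have h0 (n : ℕ) : pderiv 0 ((jordanDiff ^ n) v) = (jordanDiff ^ n) (pderiv 0 v) := by
    induction n with
    | zero => simp
    | succ n ih => rw [jordanDiff_pow_succ, pderiv_zero_jordanDiff, ih, jordanDiff_pow_succ]
  induction n with
  | zero =>
    refine ⟨pderiv 1 v + pderiv 0 v, hv.pderiv.add hv.pderiv, ?_⟩
    simp only [zero_add, pow_one, pow_zero, Module.End.one_apply, pderiv_one_jordanDiff, map_add,
      Nat.cast_zero, one_smul]
    ring
  | succ n ih =>
    obtain ⟨b, hb, e⟩ := ih
    refine ⟨b + pderiv 0 v, hb.add hv.pderiv, ?_⟩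
    rw [jordanDiff_pow_succ, pderiv_one_jordanDiff, e, h0]
    simp only [map_add, map_smul, ← jordanDiff_pow_succ]
    push_cast
    module

/-- Commuting `∂₂` past a power of `Δ` costs two factors `Δ` and produces a nonnegative multiple of
`∂₀` in leading order. -/
theorem exists_pderiv_two_jordanDiff_pow {k : ℕ} {v : MvPolynomial (Fin 3) ℝ}
    (hv : v.IsHomogeneous (k + 1)) (n : ℕ) :
    ∃ (c : ℝ) (b : MvPolynomial (Fin 3) ℝ), 0 ≤ c ∧ b.IsHomogeneous k ∧
      pderiv 2 ((jordanDiff ^ (n + 2)) v) =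
        c • (jordanDiff ^ n) (pderiv 0 v) + (jordanDiff ^ (n + 1)) b := by
  induction n with
  | zero =>
    obtain ⟨b, hb, e⟩ := exists_pderiv_one_jordanDiff_pow hv 0
    refine ⟨1, jordanDiff (pderiv 2 v) + jordanDiff (pderiv 1 v) + pderiv 1 v +
      jordanDiff b + b + pderiv 0 v, by norm_num, ?_, ?_⟩
    · exact ((((hv.pderiv.jordanDiff.add hv.pderiv.jordanDiff).add hv.pderiv).add
        hb.jordanDiff).add hb).add hv.pderiv
    · simp only [zero_add, pow_one, pow_zero, Module.End.one_apply, Nat.cast_zero, one_smul] at e ⊢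
      rw [jordanDiff_pow_succ, pderiv_two_jordanDiff, pow_one, pderiv_two_jordanDiff, e]
      simp only [map_add]
      module
  | succ n ih =>
    obtain ⟨c, b, hc, hb, e⟩ := ih
    obtain ⟨b', hb', e'⟩ := exists_pderiv_one_jordanDiff_pow hv (n + 1)
    refine ⟨c + (n + 2), b + ((n : ℝ) + 2) • pderiv 0 v + b' + jordanDiff b', by positivity, ?_, ?_⟩
    · refine ((hb.add ?_).add hb').add hb'.jordanDiff
      rw [smul_eq_C_mul]
      exact hv.pderiv.C_mul _
    · rw [jordanDiff_pow_succ, pderiv_two_jordanDiff, e, e']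
      simp only [map_add, map_smul, ← jordanDiff_pow_succ, jordanDiff_pow_jordanDiff]
      push_cast
      module

/-- The divergence operator of the homological equation is onto. Modulo `Δ ^ (m + 1)` it acts on
the image of `Δ ^ m` as a positive multiple of `∂₀`, so it is onto by nilpotency of `Δ`. -/
theorem exists_divergence_eq {k : ℕ} {w : MvPolynomial (Fin 3) ℝ} (hw : w.IsHomogeneous k) :
    ∃ u : MvPolynomial (Fin 3) ℝ, u.IsHomogeneous (k + 1) ∧
      pderiv 0 (jordanSubst u) + pderiv 1 (jordanDiff (jordanSubst u)) +
        pderiv 2 (jordanDiff (jordanDiff u)) = w := by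
  suffices H : ∀ m ≤ 2 * k + 1, ∀ w : MvPolynomial (Fin 3) ℝ, w.IsHomogeneous k →
      ∃ u : MvPolynomial (Fin 3) ℝ, u.IsHomogeneous (k + 1) ∧
      pderiv 0 (jordanSubst u) + pderiv 1 (jordanDiff (jordanSubst u)) +
        pderiv 2 (jordanDiff (jordanDiff u)) = (jordanDiff ^ m) w by
    simpa using H 0 (Nat.zero_le _) w hw
  intro m hm
  induction hm using Nat.decreasingInduction with
  | self =>
    intro w hw
    exact ⟨0, isHomogeneous_zero _ _ _, by simp [hw.jordanDiff_pow_eq_zero]⟩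
  | of_succ m hm ih =>
    intro w hw
    obtain ⟨v, hv, rfl⟩ := hw.exists_pderiv_eq 0
    have h0 (n : ℕ) : pderiv 0 ((jordanDiff ^ n) v) = (jordanDiff ^ n) (pderiv 0 v) := by
      induction n with
      | zero => simp
      | succ n ih => rw [jordanDiff_pow_succ, pderiv_zero_jordanDiff, ih, jordanDiff_pow_succ]
    obtain ⟨b, hb, e⟩ := exists_pderiv_one_jordanDiff_pow hv m
    obtain ⟨b', hb', e'⟩ := exists_pderiv_one_jordanDiff_pow hv (m + 1)
    obtain ⟨c, b'', hc, hb'', e''⟩ := exists_pderiv_two_jordanDiff_pow hv m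
    obtain ⟨u, hu, eu⟩ := ih (pderiv 0 v + b + ((m : ℝ) + 2) • pderiv 0 v + jordanDiff b' + b'') (by
      refine (((hv.pderiv.add hb).add ?_).add hb'.jordanDiff).add hb''
      rw [smul_eq_C_mul]
      exact hv.pderiv.C_mul _)
    set C : ℝ := m + 2 + c with hC
    have hC0 : C ≠ 0 := by positivity
    refine ⟨C⁻¹ • ((jordanDiff ^ m) v - u), ?_, ?_⟩
    · rw [smul_eq_C_mul]
      exact ((hv.jordanDiff_pow m).sub hu).C_mul _
    · have key : pderiv 0 (jordanSubst ((jordanDiff ^ m) v)) +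
          pderiv 1 (jordanDiff (jordanSubst ((jordanDiff ^ m) v))) +
          pderiv 2 (jordanDiff (jordanDiff ((jordanDiff ^ m) v))) =
          C • (jordanDiff ^ m) (pderiv 0 v) + (jordanDiff ^ (m + 1))
            (pderiv 0 v + b + ((m : ℝ) + 2) • pderiv 0 v + jordanDiff b' + b'') := by
        simp only [jordanSubst_eq, map_add, ← jordanDiff_pow_succ, h0, e, e', e'',
          jordanDiff_pow_jordanDiff, map_smul, hC]
        push_cast
        module
      rw [← eu] at key
      simp only [map_smul, map_sub, Derivation.map_smul]
      rw [show (jordanDiff ^ m) (pderiv 0 v) = C⁻¹ • C • (jordanDiff ^ m) (pderiv 0 v) by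
        rw [smul_smul, inv_mul_cancel₀ hC0, one_smul], ← sub_eq_iff_eq_add.2 key]
      simp only [smul_sub, smul_add]
      ring

/-- The homological equation: every homogeneous divergence-free field `S` equals
`h - J⁻¹ (h ∘ J) + r ê₃` with `h = (u, v, w)` homogeneous and divergence-free and `r` a
homogeneous polynomial in the first two variables. -/
theorem exists_homological_solution {k : ℕ} {S : Fin 3 → MvPolynomial (Fin 3) ℝ}
    (hS : ∀ i, (S i).IsHomogeneous (k + 1)) (hdiv : ∑ i, pderiv i (S i) = 0) :
    ∃ (h : Fin 3 → MvPolynomial (Fin 3) ℝ) (r : MvPolynomial (Fin 3) ℝ),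
      (∀ i, (h i).IsHomogeneous (k + 1)) ∧ ∑ i, pderiv i (h i) = 0 ∧
      r.IsHomogeneous (k + 1) ∧ pderiv 2 r = 0 ∧
      S 0 = h 0 - jordanSubst (h 0 - h 1 + h 2) ∧
      S 1 = h 1 - jordanSubst (h 1 - h 2) ∧
      S 2 = h 2 - jordanSubst (h 2) + r := by
  -- The components are solved for successively: `u = a ∘ J` is the free unknown, the first two
  -- equations determine `v` and `w`, and `a` is chosen to make the divergence vanish.
  set w₀ := jordanSubstInv (jordanDiff (S 0 + S 1) + S 1) with hw₀
  have h01 := (hS 0).add (hS 1)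
  have hw₀h : w₀.IsHomogeneous (k + 1) := (h01.jordanDiff.add (hS 1)).jordanSubstInv
  obtain ⟨a, ha, ea⟩ := exists_divergence_eq
    ((h01.pderiv (i := 1)).add (hw₀h.pderiv (i := 2))).neg
  set u := jordanSubst a with hu
  set v := jordanDiff u + S 0 + S 1 with hv
  set w := jordanDiff (jordanDiff a) + w₀ with hw
  have hAw : jordanSubst w = jordanDiff v + S 1 := by
    rw [hw, map_add, hw₀, jordanSubst_jordanSubstInv, hv, hu]
    simp only [jordanSubst_eq, map_add]
    ring
  have huh : u.IsHomogeneous (k + 1) := ha.jordanSubst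
  have hvh : v.IsHomogeneous (k + 1) := (huh.jordanDiff.add (hS 0)).add (hS 1)
  have hwh : w.IsHomogeneous (k + 1) := ha.jordanDiff.jordanDiff.add hw₀h
  have hdivh : pderiv 0 u + pderiv 1 v + pderiv 2 w = 0 := by
    simp only [hv, hw, map_add]
    simp only [map_add] at ea
    linear_combination ea
  have e0 : S 0 = u - jordanSubst (u - v + w) := by
    rw [map_add, map_sub, hAw, jordanSubst_eq u, jordanSubst_eq v]
    linear_combination -hv
  have e1 : S 1 = v - jordanSubst (v - w) := by
    rw [map_sub, hAw, jordanSubst_eq v]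
    ring
  refine ⟨![u, v, w], S 2 + jordanDiff w, ?_, ?_, (hS 2).add hwh.jordanDiff, ?_, e0, e1, ?_⟩
  · intro i
    fin_cases i <;> assumption
  · simpa [Fin.sum_univ_three] using hdivh
  · -- the divergence of `J⁻¹ (h ∘ J)` is `(div h) ∘ J = 0`
    rw [Fin.sum_univ_three, e0, e1] at hdiv
    have hA := congrArg jordanSubst hdivh
    rw [jordanDiff_apply]
    simp only [map_add, map_sub, map_zero, (pderiv_jordanSubst _).1, (pderiv_jordanSubst _).2.1,
      (pderiv_jordanSubst _).2.2] at hdiv hA ⊢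
    linear_combination hdiv - hdivh + hA
  · simp only [jordanDiff_apply, Matrix.cons_val]
    ring

/-! ### Taylor expansion at the origin -/

/-- The partial derivative of a real function on `ℝ³` along the `i`-th coordinate. -/
noncomputable def partialDeriv (i : Fin 3) (φ : E3 → ℝ) (ξ : E3) : ℝ :=
  fderiv ℝ φ ξ (EuclideanSpace.single i 1)

/-- The function on `ℝ³` given by a polynomial. -/
noncomputable def polyFun (p : MvPolynomial (Fin 3) ℝ) (ξ : E3) : ℝ :=
  eval (fun j => ξ j) p

theorem hasFDerivAt_coord (i : Fin 3) (ξ : E3) :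
    HasFDerivAt (fun ξ : E3 => ξ i) (EuclideanSpace.proj i : E3 →L[ℝ] ℝ) ξ :=
  (EuclideanSpace.proj i : E3 →L[ℝ] ℝ).hasFDerivAt

theorem contDiff_coord (i : Fin 3) {n : WithTop ℕ∞} : ContDiff ℝ n (fun ξ : E3 => ξ i) :=
  (EuclideanSpace.proj i : E3 →L[ℝ] ℝ).contDiff

theorem contDiff_polyFun (p : MvPolynomial (Fin 3) ℝ) {n : WithTop ℕ∞} :
    ContDiff ℝ n (polyFun p) := by
  unfold polyFun
  induction p using MvPolynomial.induction_on with
  | C a => simpa using contDiff_const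
  | add p q hp hq => simpa using hp.add hq
  | mul_X p i hp => simpa using hp.mul (contDiff_coord i)

theorem partialDeriv_polyFun (i : Fin 3) (p : MvPolynomial (Fin 3) ℝ) :
    partialDeriv i (polyFun p) = polyFun (pderiv i p) := by
  funext ξ
  have hd (p : MvPolynomial (Fin 3) ℝ) : DifferentiableAt ℝ (polyFun p) ξ :=
    (contDiff_polyFun p (n := 1)).differentiable one_ne_zero ξ
  induction p using MvPolynomial.induction_on with
  | C a =>
    have : polyFun (C a) = fun _ => a := by funext ξ; simp [polyFun]
    rw [this]; simp [partialDeriv, polyFun]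
  | add p q hp hq =>
    have : polyFun (p + q) = polyFun p + polyFun q := by funext ξ; simp [polyFun]
    rw [this, partialDeriv, fderiv_add (hd p) (hd q)]
    simp only [partialDeriv] at hp hq
    simp [hp, hq, polyFun]
  | mul_X p j hp =>
    have : polyFun (p * X j) = polyFun p * fun ξ => ξ j := by funext ξ; simp [polyFun]
    rw [this, partialDeriv, fderiv_mul (hd p) (hasFDerivAt_coord j ξ).differentiableAt,
      (hasFDerivAt_coord j ξ).fderiv]
    simp only [partialDeriv] at hp
    simp only [add_apply, smul_apply, hp]
    by_cases h : j = i
    · subst h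
      simp [polyFun]
    · simp [polyFun, pderiv_X_of_ne h, h]

theorem fderiv_eq_sum_partialDeriv (φ : E3 → ℝ) (ξ v : E3) :
    fderiv ℝ φ ξ v = ∑ i, v i * partialDeriv i φ ξ := by
  conv_lhs => rw [← (EuclideanSpace.basisFun (Fin 3) ℝ).sum_repr v]
  simp [partialDeriv]

theorem norm_fderiv_le_sum (φ : E3 → ℝ) (ξ : E3) :
    ‖fderiv ℝ φ ξ‖ ≤ ∑ i, ‖partialDeriv i φ ξ‖ := by
  refine ContinuousLinearMap.opNorm_le_bound _ (by positivity) fun v => ?_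
  rw [fderiv_eq_sum_partialDeriv, Finset.sum_mul]
  refine (norm_sum_le _ _).trans (Finset.sum_le_sum fun i _ => ?_)
  rw [norm_mul, mul_comm]
  gcongr
  exact PiLp.norm_apply_le v i

theorem contDiff_partialDeriv {φ : E3 → ℝ} (hφ : ContDiff ℝ ∞ φ) (i : Fin 3) :
    ContDiff ℝ ∞ (partialDeriv i φ) :=
  (hφ.fderiv_right (m := ∞) (by simp)).clm_apply contDiff_const

theorem partialDeriv_comm {φ : E3 → ℝ} (hφ : ContDiff ℝ ∞ φ) (i j : Fin 3) :
    partialDeriv i (partialDeriv j φ) = partialDeriv j (partialDeriv i φ) := by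
  funext ξ
  have hd : DifferentiableAt ℝ (fderiv ℝ φ) ξ :=
    (hφ.fderiv_right (m := 1) (by norm_cast)).differentiable one_ne_zero ξ
  have e (i j : Fin 3) : partialDeriv i (partialDeriv j φ) ξ =
      fderiv ℝ (fderiv ℝ φ) ξ (EuclideanSpace.single i 1) (EuclideanSpace.single j 1) := by
    have : partialDeriv j φ = fun ξ => fderiv ℝ φ ξ (EuclideanSpace.single j 1) := rfl
    rw [partialDeriv, this, fderiv_clm_apply hd (differentiableAt_const _)]
    simp
  rw [e, e]
  exact (hφ.contDiffAt.isSymmSndFDerivAt (by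
    rw [minSmoothness_of_isRCLikeNormedField]
    exact WithTop.coe_le_coe.2 (OrderTop.le_top (2 : ℕ∞)))).eq _ _

theorem partialDeriv_sub {φ ψ : E3 → ℝ} (hφ : ContDiff ℝ ∞ φ) (hψ : ContDiff ℝ ∞ ψ) (i : Fin 3) :
    partialDeriv i (φ - ψ) = partialDeriv i φ - partialDeriv i ψ := by
  funext ξ
  rw [partialDeriv, fderiv_sub (hφ.differentiable (by simp) ξ) (hψ.differentiable (by simp) ξ)]
  rfl

/-- `VanishesToOrder k φ` means that `φ` is smooth and that its partial derivatives of order less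
than `k` vanish at the origin. -/
def VanishesToOrder : ℕ → (E3 → ℝ) → Prop
  | 0, φ => ContDiff ℝ ∞ φ
  | k + 1, φ => ContDiff ℝ ∞ φ ∧ φ 0 = 0 ∧ ∀ i, VanishesToOrder k (partialDeriv i φ)

namespace VanishesToOrder

theorem contDiff {k : ℕ} {φ : E3 → ℝ} (h : VanishesToOrder k φ) : ContDiff ℝ ∞ φ := by
  cases k with
  | zero => exact h
  | succ k => exact h.1

theorem sub {k : ℕ} {φ ψ : E3 → ℝ} (h : VanishesToOrder k φ) (h' : VanishesToOrder k ψ) :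
    VanishesToOrder k (φ - ψ) := by
  induction k generalizing φ ψ with
  | zero => exact ContDiff.sub h h'
  | succ k ih =>
    refine ⟨h.1.sub h'.1, by simp [h.2.1, h'.2.1], fun i => ?_⟩
    rw [partialDeriv_sub h.1 h'.1]
    exact ih (h.2.2 i) (h'.2.2 i)

end VanishesToOrder

theorem isBigO_norm_pow_of_le {m n : ℕ} (h : m ≤ n) :
    (fun ξ : E3 => ‖ξ‖ ^ n) =O[𝓝 0] (fun ξ : E3 => ‖ξ‖ ^ m) := by
  refine IsBigO.of_bound 1 ?_
  filter_upwards [Metric.closedBall_mem_nhds (0 : E3) one_pos] with ξ hξ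
  rw [mem_closedBall_zero_iff] at hξ
  simpa using pow_le_pow_of_le_one (norm_nonneg ξ) hξ h

/-- A function whose derivative is `O(‖ξ‖ ^ k)` and which vanishes at `0` is
`O(‖ξ‖ ^ (k + 1))`. -/
theorem isBigO_of_fderiv {φ : E3 → ℝ} (hφ : Differentiable ℝ φ) (h0 : φ 0 = 0) {k : ℕ}
    (h : (fderiv ℝ φ) =O[𝓝 0] (fun ξ : E3 => ‖ξ‖ ^ k)) :
    φ =O[𝓝 0] (fun ξ : E3 => ‖ξ‖ ^ (k + 1)) := by
  obtain ⟨C, hC0, hC⟩ := h.exists_pos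
  obtain ⟨r, hr, hb⟩ := Metric.eventually_nhds_iff_ball.1 hC.bound
  refine IsBigO.of_bound C (Metric.eventually_nhds_iff_ball.2 ⟨r, hr, fun ξ hξ => ?_⟩)
  rw [mem_ball_zero_iff] at hξ
  have hC' : ∀ η ∈ Metric.closedBall (0 : E3) ‖ξ‖, ‖fderiv ℝ φ η‖ ≤ C * ‖ξ‖ ^ k := by
    intro η hη
    rw [mem_closedBall_zero_iff] at hη
    refine (hb η (mem_ball_zero_iff.2 (hη.trans_lt hξ))).trans ?_
    rw [norm_pow, norm_norm]
    gcongr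
  have := (convex_closedBall (0 : E3) ‖ξ‖).norm_image_sub_le_of_norm_fderiv_le (𝕜 := ℝ)
    (fun η _ => hφ η) hC' (by simp : (0 : E3) ∈ Metric.closedBall (0 : E3) ‖ξ‖)
    (by simp : ξ ∈ Metric.closedBall (0 : E3) ‖ξ‖)
  rw [h0, sub_zero, sub_zero] at this
  rw [norm_pow, norm_norm, pow_succ, ← mul_assoc]
  exact this

theorem isBigO_fderiv_of_partialDeriv {φ : E3 → ℝ} {g : E3 → ℝ}
    (h : ∀ i, partialDeriv i φ =O[𝓝 0] g) : fderiv ℝ φ =O[𝓝 0] g := by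
  have h1 : (fun ξ => ∑ i, ‖partialDeriv i φ ξ‖) =O[𝓝 0] g :=
    IsBigO.fun_sum fun i _ => (h i).norm_left
  refine (IsBigO.of_bound 1 (Eventually.of_forall fun ξ => ?_)).trans h1
  rw [one_mul, Real.norm_of_nonneg (by positivity)]
  exact norm_fderiv_le_sum φ ξ

theorem VanishesToOrder.isBigO {k : ℕ} {φ : E3 → ℝ} (h : VanishesToOrder k φ) :
    φ =O[𝓝 0] (fun ξ : E3 => ‖ξ‖ ^ k) := by
  induction k generalizing φ with
  | zero =>
    simpa using (h.contDiff.continuous.tendsto 0).isBigO_one ℝ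
  | succ k ih =>
    exact isBigO_of_fderiv (h.contDiff.differentiable (by simp)) h.2.1
      (isBigO_fderiv_of_partialDeriv fun i => ih (h.2.2 i))

theorem MvPolynomial.IsHomogeneous.vanishesToOrder {k : ℕ} {p : MvPolynomial (Fin 3) ℝ}
    (hp : p.IsHomogeneous k) : VanishesToOrder k (polyFun p) := by
  induction k generalizing p with
  | zero => exact contDiff_polyFun p
  | succ k ih =>
    refine ⟨contDiff_polyFun p, ?_, fun i => ?_⟩
    · have := hp.coeff_eq_zero (d := 0) (by simp)
      have e : polyFun p 0 = constantCoeff p := by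
        simp only [polyFun, PiLp.zero_apply]
        exact congrFun (congrArg DFunLike.coe (eval_zero' (σ := Fin 3) (R := ℝ))) p
      rw [e]
      exact this
    · rw [partialDeriv_polyFun]
      exact ih hp.pderiv

theorem polyFun_smul {k : ℕ} {p : MvPolynomial (Fin 3) ℝ} (hp : p.IsHomogeneous k) (t : ℝ)
    (ξ : E3) : polyFun p (t • ξ) = t ^ k * polyFun p ξ := by
  simp only [polyFun, eval_eq, Finset.mul_sum]
  refine Finset.sum_congr rfl fun s hs => ?_
  have h := hp.degree_eq_of_mem_support hs
  simp only [PiLp.smul_apply, smul_eq_mul, mul_pow, Finset.prod_mul_distrib]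
  rw [Finset.prod_pow_eq_pow_sum, ← Finsupp.degree_apply, h]
  ring

/-- A homogeneous polynomial of degree `k` which is `O(‖ξ‖ ^ (k + 1))` vanishes. -/
theorem MvPolynomial.IsHomogeneous.eq_zero_of_isBigO {k : ℕ} {p : MvPolynomial (Fin 3) ℝ}
    (hp : p.IsHomogeneous k) (h : polyFun p =O[𝓝 0] (fun ξ : E3 => ‖ξ‖ ^ (k + 1))) : p = 0 := by
  refine MvPolynomial.funext fun x => ?_
  rw [map_zero]
  set ξ : E3 := WithLp.toLp 2 x with hξ
  have ht : Tendsto (fun t : ℝ => t • ξ) (𝓝[>] 0) (𝓝 0) := by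
    have : Tendsto (fun t : ℝ => t • ξ) (𝓝 0) (𝓝 ((0 : ℝ) • ξ)) :=
      (continuous_id.smul continuous_const).tendsto _
    rw [zero_smul] at this
    exact this.mono_left nhdsWithin_le_nhds
  have h1 : (fun t : ℝ => t ^ k * polyFun p ξ) =O[𝓝[>] 0] (fun t : ℝ => t ^ k * t) := by
    have := h.comp_tendsto ht
    refine (this.congr_left fun t => polyFun_smul hp t ξ).trans ?_
    refine IsBigO.of_bound (‖ξ‖ ^ (k + 1)) (Eventually.of_forall fun t => ?_)
    simp only [Function.comp, norm_pow, norm_mul, norm_smul, norm_norm]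
    rw [mul_pow, pow_succ ‖t‖]
    exact (mul_comm _ _).le
  have h2 : (fun _ : ℝ => polyFun p ξ) =O[𝓝[>] 0] (fun t : ℝ => t) := by
    have h4 := (isBigO_refl (fun t : ℝ => (t ^ k)⁻¹) (𝓝[>] 0)).mul h1
    refine h4.congr' ?_ ?_ <;> filter_upwards [self_mem_nhdsWithin] with t ht
    all_goals
      have : t ^ k ≠ 0 := pow_ne_zero _ (ne_of_gt ht)
      rw [inv_mul_cancel_left₀ this]
  have h3 : Tendsto (fun _ : ℝ => polyFun p ξ) (𝓝[>] 0) (𝓝 0) :=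
    h2.trans_tendsto (tendsto_id.mono_left nhdsWithin_le_nhds)
  exact tendsto_nhds_unique tendsto_const_nhds h3

/-- The leading Taylor polynomial of a function vanishing to order `k`. -/
theorem VanishesToOrder.exists_taylor {k : ℕ} {φ : E3 → ℝ} (h : VanishesToOrder k φ) :
    ∃ p : MvPolynomial (Fin 3) ℝ, p.IsHomogeneous k ∧ VanishesToOrder (k + 1) (φ - polyFun p) := by
  induction k generalizing φ with
  | zero =>
    refine ⟨C (φ 0), isHomogeneous_C _ _, h.contDiff.sub (contDiff_polyFun _),
      by simp [polyFun], fun i => ?_⟩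
    exact contDiff_partialDeriv (h.contDiff.sub (contDiff_polyFun _)) i
  | succ k ih =>
    choose q hq hq' using fun i => ih (h.2.2 i)
    -- The polynomials `q i` approximating `∂ᵢ φ` form a closed form, and Euler's identity
    -- integrates it.
    have hclosed (i j : Fin 3) : pderiv j (q i) = pderiv i (q j) := by
      cases k with
      | zero =>
        have h0 (i j : Fin 3) : pderiv j (q i) = 0 := by
          rw [(totalDegree_eq_zero_iff_eq_C (p := q i)).1 (Nat.le_zero.1 (hq i).totalDegree_le),
            pderiv_C]
        rw [h0, h0]
      | succ k =>
        have h1 := (hq' i).2.2 j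
        have h2 := (hq' j).2.2 i
        rw [partialDeriv_sub (contDiff_partialDeriv h.1 _) (contDiff_polyFun _),
          partialDeriv_polyFun] at h1 h2
        have h3 := h1.sub h2
        rw [partialDeriv_comm h.1 j i] at h3
        refine (sub_eq_zero.1 (IsHomogeneous.eq_zero_of_isBigO (k := k)
          ((hq i).pderiv.sub (hq j).pderiv) ?_))
        refine (h3.isBigO.neg_left).congr_left fun ξ => ?_
        simp [polyFun]
    have hEuler (j : Fin 3) : ∑ i, X i * pderiv i (q j) = k • q j := (hq j).sum_X_mul_pderiv
    refine ⟨C ((k : ℝ) + 1)⁻¹ * ∑ i, X i * q i, ?_, h.1.sub (contDiff_polyFun _), ?_, fun j => ?_⟩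
    · refine IsHomogeneous.C_mul (IsHomogeneous.sum _ _ _ fun i _ => ?_) _
      rw [add_comm]
      exact (isHomogeneous_X _ _).mul (hq i)
    · simp [polyFun, h.2.1]
    · rw [partialDeriv_sub h.1 (contDiff_polyFun _), partialDeriv_polyFun]
      have : pderiv j (C ((k : ℝ) + 1)⁻¹ * ∑ i, X i * q i) = q j := by
        rw [pderiv_C_mul, map_sum]
        simp only [pderiv_mul]
        rw [Finset.sum_add_distrib]
        have e1 : ∑ i, pderiv j (X i) * q i = q j := by
          rw [Finset.sum_eq_single j]
          · simp
          · intro i _ hi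
            rw [pderiv_X_of_ne hi, zero_mul]
          · simp
        simp only [hclosed _ j]
        rw [e1, hEuler, nsmul_eq_mul]
        have : (k : ℝ) + 1 ≠ 0 := by positivity
        have e2 : q j + (k : MvPolynomial (Fin 3) ℝ) * q j = C ((k : ℝ) + 1) * q j := by
          simp only [map_add, map_natCast, map_one]; ring
        rw [e2, ← mul_assoc, ← C_mul, inv_mul_cancel₀ this, C_1, one_mul]
      rw [this]
      exact hq' j

/-- A smooth function of order `O(‖ξ‖ ^ k)` vanishes to order `k`: its leading Taylor polynomials of
lower degree are themselves too small to be nonzero. -/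
theorem VanishesToOrder.of_isBigO {k : ℕ} {φ : E3 → ℝ} (hφ : ContDiff ℝ ∞ φ)
    (h : φ =O[𝓝 0] (fun ξ : E3 => ‖ξ‖ ^ k)) : VanishesToOrder k φ := by
  induction k with
  | zero => exact hφ
  | succ k ih =>
    obtain ⟨p, hp, hp'⟩ := (ih (h.trans (isBigO_norm_pow_of_le k.le_succ))).exists_taylor
    have : p = 0 := by
      refine hp.eq_zero_of_isBigO ((h.sub hp'.isBigO).congr_left fun ξ => ?_)
      simp
    subst this
    have e : φ - polyFun 0 = φ := by funext ξ; simp [polyFun]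
    rwa [e] at hp'

/-- The derivative of a smooth function which is `O(‖ξ‖ ^ (k + 1))` is `O(‖ξ‖ ^ k)`. -/
theorem isBigO_fderiv {k : ℕ} {φ : E3 → ℝ} (hφ : ContDiff ℝ ∞ φ)
    (h : φ =O[𝓝 0] (fun ξ : E3 => ‖ξ‖ ^ (k + 1))) :
    fderiv ℝ φ =O[𝓝 0] (fun ξ : E3 => ‖ξ‖ ^ k) :=
  isBigO_fderiv_of_partialDeriv fun i => ((VanishesToOrder.of_isBigO hφ h).2.2 i).isBigO

theorem isBigO_partialDeriv {k : ℕ} {φ : E3 → ℝ} (hφ : ContDiff ℝ ∞ φ)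
    (h : φ =O[𝓝 0] (fun ξ : E3 => ‖ξ‖ ^ (k + 1))) (i : Fin 3) :
    partialDeriv i φ =O[𝓝 0] (fun ξ : E3 => ‖ξ‖ ^ k) :=
  ((VanishesToOrder.of_isBigO hφ h).2.2 i).isBigO

/-! ### Orders of vanishing of compositions -/

/-- If `φ = O(m + 1)` and `a - b = O(k)`, then `φ ∘ a - φ ∘ b = O(k + m)`. -/
theorem isBigO_comp_sub_comp {k m : ℕ} {φ : E3 → ℝ} (hφ : ContDiff ℝ ∞ φ)
    (h : φ =O[𝓝 0] (fun ξ : E3 => ‖ξ‖ ^ (m + 1))) {a b : E3 → E3}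
    (ha : a =O[𝓝 0] (fun ξ : E3 => ‖ξ‖ ^ 1)) (hb : b =O[𝓝 0] (fun ξ : E3 => ‖ξ‖ ^ 1))
    (hab : (fun ξ => a ξ - b ξ) =O[𝓝 0] (fun ξ : E3 => ‖ξ‖ ^ k)) :
    (fun ξ => φ (a ξ) - φ (b ξ)) =O[𝓝 0] (fun ξ : E3 => ‖ξ‖ ^ (k + m)) := by
  obtain ⟨D, hD0, hD⟩ := (isBigO_fderiv hφ h).exists_pos
  obtain ⟨r, hr, hDr⟩ := Metric.eventually_nhds_iff_ball.1 hD.bound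
  obtain ⟨A, hA0, hA⟩ := ha.exists_pos
  obtain ⟨B, hB0, hB⟩ := hb.exists_pos
  have hsmall : ∀ᶠ ξ : E3 in 𝓝 0, (A + B) * ‖ξ‖ < r := by
    have : Tendsto (fun ξ : E3 => (A + B) * ‖ξ‖) (𝓝 0) (𝓝 ((A + B) * ‖(0 : E3)‖)) :=
      (continuous_const.mul continuous_norm).tendsto _
    rw [norm_zero, mul_zero] at this
    exact this.eventually_lt_const hr
  have key : (fun ξ => φ (a ξ) - φ (b ξ)) =O[𝓝 0]
      (fun ξ : E3 => (D * (A + B) ^ m) * (‖a ξ - b ξ‖ * ‖ξ‖ ^ m)) := by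
    refine IsBigO.of_bound 1 ?_
    filter_upwards [hsmall, hA.bound, hB.bound] with ξ h1 h2 h3
    rw [pow_one, norm_norm] at h2 h3
    have hbd : ∀ η ∈ Metric.closedBall (0 : E3) ((A + B) * ‖ξ‖),
        ‖fderiv ℝ φ η‖ ≤ D * ((A + B) * ‖ξ‖) ^ m := by
      intro η hη
      rw [mem_closedBall_zero_iff] at hη
      refine (hDr η (mem_ball_zero_iff.2 (hη.trans_lt h1))).trans ?_
      rw [norm_pow, norm_norm]
      gcongr
    have hx := norm_nonneg ξ
    have := (convex_closedBall (0 : E3) ((A + B) * ‖ξ‖)).norm_image_sub_le_of_norm_fderiv_le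
      (𝕜 := ℝ) (fun η _ => hφ.differentiable (by simp) η) hbd
      (mem_closedBall_zero_iff.2 (h3.trans (by nlinarith)))
      (mem_closedBall_zero_iff.2 (h2.trans (by nlinarith)))
    refine this.trans (le_of_eq ?_)
    rw [one_mul, Real.norm_of_nonneg (by positivity), mul_pow]
    ring
  refine (key.trans (isBigO_const_mul_self _ _ _)).trans ?_
  simp only [pow_add]
  exact hab.norm_left.mul (isBigO_refl _ _)

theorem isBigO_of_coord {f : E3 → E3} {g : E3 → ℝ} (h : ∀ i, (fun ξ => f ξ i) =O[𝓝 0] g) :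
    f =O[𝓝 0] g := by
  have h1 : (fun ξ => ∑ i, ‖f ξ i‖) =O[𝓝 0] g := IsBigO.fun_sum fun i _ => (h i).norm_left
  refine (IsBigO.of_bound 1 (Eventually.of_forall fun ξ => ?_)).trans h1
  rw [one_mul, Real.norm_of_nonneg (by positivity)]
  conv_lhs => rw [← (EuclideanSpace.basisFun (Fin 3) ℝ).sum_repr (f ξ)]
  refine (norm_sum_le _ _).trans (Finset.sum_le_sum fun i _ => ?_)
  simp [norm_smul]

theorem isBigO_coord {f : E3 → E3} {g : E3 → ℝ} (h : f =O[𝓝 0] g) (i : Fin 3) :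
    (fun ξ => f ξ i) =O[𝓝 0] g :=
  (IsBigO.of_bound 1 (Eventually.of_forall fun ξ => by
    rw [one_mul]; exact PiLp.norm_apply_le (f ξ) i)).trans h

/-- Vector-valued form of `isBigO_comp_sub_comp`. -/
theorem isBigO_comp_sub_comp_vector {k m : ℕ} {φ : E3 → E3} (hφ : ContDiff ℝ ∞ φ)
    (h : φ =O[𝓝 0] (fun ξ : E3 => ‖ξ‖ ^ (m + 1))) {a b : E3 → E3}
    (ha : a =O[𝓝 0] (fun ξ : E3 => ‖ξ‖ ^ 1)) (hb : b =O[𝓝 0] (fun ξ : E3 => ‖ξ‖ ^ 1))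
    (hab : (fun ξ => a ξ - b ξ) =O[𝓝 0] (fun ξ : E3 => ‖ξ‖ ^ k)) :
    (fun ξ => φ (a ξ) - φ (b ξ)) =O[𝓝 0] (fun ξ : E3 => ‖ξ‖ ^ (k + m)) :=
  isBigO_of_coord fun i =>
    isBigO_comp_sub_comp (contDiff_euclidean.1 hφ i) (isBigO_coord h i) ha hb hab

theorem isBigO_one_of_contDiff {f : E3 → E3} (hf : ContDiff ℝ ∞ f) (h0 : f 0 = 0) :
    f =O[𝓝 0] (fun ξ : E3 => ‖ξ‖ ^ 1) := by
  have := (hf.differentiable (by simp) 0).isBigO_sub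
  simpa [h0] using this.norm_right

/-- Precomposition with a map of order `O(1)` preserves orders of vanishing. -/
theorem isBigO_comp {E : Type*} [NormedAddCommGroup E] {k : ℕ} {f : E3 → E}
    (hf : f =O[𝓝 0] (fun ξ : E3 => ‖ξ‖ ^ k)) {a : E3 → E3}
    (ha : a =O[𝓝 0] (fun ξ : E3 => ‖ξ‖ ^ 1)) :
    (fun ξ => f (a ξ)) =O[𝓝 0] (fun ξ : E3 => ‖ξ‖ ^ k) := by
  have ht : Tendsto a (𝓝 0) (𝓝 0) := by
    refine ha.trans_tendsto ?_
    simpa using (continuous_norm (E := E3)).tendsto 0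
  refine (hf.comp_tendsto ht).trans ?_
  simp only [pow_one] at ha
  exact ha.norm_left.pow k

/-! ### Volume preservation and shears -/

/-- The determinant of the derivative is the Jacobian determinant. -/
theorem det_fderiv_eq {f : E3 → E3} (hf : Differentiable ℝ f) (ξ : E3) :
    (fderiv ℝ f ξ).det =
      Matrix.det (Matrix.of fun i j => partialDeriv j (fun η => f η i) ξ) := by
  rw [ContinuousLinearMap.det, ← LinearMap.det_toMatrix (EuclideanSpace.basisFun (Fin 3) ℝ).toBasis]
  congr 1
  ext i j
  rw [LinearMap.toMatrix_apply]
  have h : HasFDerivAt (fun η => f η i)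
      ((EuclideanSpace.proj i : E3 →L[ℝ] ℝ).comp (fderiv ℝ f ξ)) ξ :=
    (hasFDerivAt_coord i (f ξ)).comp ξ (hf ξ).hasFDerivAt
  simp [partialDeriv, h.fderiv]

theorem IsVolumePreserving.comp {f g : E3 → E3} (hf : IsVolumePreserving f)
    (hg : IsVolumePreserving g) : IsVolumePreserving (fun ξ => f (g ξ)) := by
  refine ⟨hf.1.comp hg.1, fun ξ => ?_⟩
  have : fderiv ℝ (fun ξ => f (g ξ)) ξ = (fderiv ℝ f (g ξ)).comp (fderiv ℝ g ξ) :=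
    fderiv_comp ξ (hf.1 _) (hg.1 _)
  rw [this, ContinuousLinearMap.det, ContinuousLinearMap.toLinearMap_comp, LinearMap.det_comp]
  have h1 := hf.2 (g ξ)
  have h2 := hg.2 ξ
  rw [ContinuousLinearMap.det] at h1 h2
  rw [h1, h2, one_mul]

theorem isVolumePreserving_id : IsVolumePreserving (fun ξ => ξ) := by
  refine ⟨differentiable_id, fun ξ => ?_⟩
  rw [fderiv_fun_id, ContinuousLinearMap.det]
  exact LinearMap.det_id

theorem IsVolumePreserving.symm {f : E3 ≃ₘ[ℝ] E3} (hf : IsVolumePreserving f) :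
    IsVolumePreserving f.symm := by
  have hd : Differentiable ℝ f.symm := f.symm.contDiff.differentiable (by simp)
  refine ⟨hd, fun ξ => ?_⟩
  have h1 : fderiv ℝ (fun ξ => f (f.symm ξ)) ξ =
      (fderiv ℝ f (f.symm ξ)).comp (fderiv ℝ f.symm ξ) :=
    fderiv_comp ξ (hf.1 _) (hd _)
  simp only [Diffeomorph.apply_symm_apply, fderiv_fun_id] at h1
  have h2 := congrArg ContinuousLinearMap.det h1
  have h3 := hf.2 (f.symm ξ)
  rw [ContinuousLinearMap.det] at h3
  rw [ContinuousLinearMap.det, ContinuousLinearMap.det, ContinuousLinearMap.toLinearMap_comp,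
    LinearMap.det_comp, h3, one_mul] at h2
  rw [ContinuousLinearMap.det, ← h2]
  exact LinearMap.det_id

/-- The shear `ξ ↦ ξ + s(ξ) v` along `v`, where `s` is constant along the lines parallel to `v`. -/
noncomputable def shearDiffeo (v : E3) (s : E3 → ℝ) (hs : ContDiff ℝ ∞ s)
    (hinv : ∀ ξ (t : ℝ), s (ξ + t • v) = s ξ) : E3 ≃ₘ[ℝ] E3 where
  toFun ξ := ξ + s ξ • v
  invFun ξ := ξ - s ξ • v
  left_inv ξ := by simp [hinv]
  right_inv ξ := by
    have : s (ξ - s ξ • v) = s ξ := by rw [sub_eq_add_neg, ← neg_smul, hinv]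
    simp [this]
  contMDiff_toFun := (contDiff_id.add (hs.smul contDiff_const)).contMDiff
  contMDiff_invFun := (contDiff_id.sub (hs.smul contDiff_const)).contMDiff

theorem shearDiffeo_apply (v : E3) (s : E3 → ℝ) (hs : ContDiff ℝ ∞ s)
    (hinv : ∀ ξ (t : ℝ), s (ξ + t • v) = s ξ) (ξ : E3) :
    shearDiffeo v s hs hinv ξ = ξ + s ξ • v := rfl

theorem isVolumePreserving_shearDiffeo (v : E3) (s : E3 → ℝ) (hs : ContDiff ℝ ∞ s)
    (hinv : ∀ ξ (t : ℝ), s (ξ + t • v) = s ξ) :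
    IsVolumePreserving (shearDiffeo v s hs hinv) := by
  have hd : Differentiable ℝ (shearDiffeo v s hs hinv) :=
    (shearDiffeo v s hs hinv).contDiff.differentiable (by simp)
  refine ⟨hd, fun ξ => ?_⟩
  have hs' : DifferentiableAt ℝ s ξ := hs.differentiable (by simp) ξ
  have h0 : ∑ i, v i * partialDeriv i s ξ = 0 := by
    rw [← fderiv_eq_sum_partialDeriv]
    have h1 : HasDerivAt (fun t : ℝ => ξ + t • v) v 0 := by
      simpa using ((hasDerivAt_id (0 : ℝ)).smul_const v).const_add ξ
    have h2 : HasFDerivAt s (fderiv ℝ s ξ) (ξ + (0 : ℝ) • v) := by simpa using hs'.hasFDerivAt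
    have h3 := h2.comp_hasDerivAt (0 : ℝ) h1
    have h4 : (s ∘ fun t : ℝ => ξ + t • v) = fun _ => s ξ := by funext t; exact hinv ξ t
    rw [h4] at h3
    exact h3.unique (hasDerivAt_const _ _)
  have he (i j : Fin 3) : partialDeriv j (fun η => shearDiffeo v s hs hinv η i) ξ =
      (if i = j then 1 else 0) + v i * partialDeriv j s ξ := by
    have : (fun η => shearDiffeo v s hs hinv η i) = fun η => η i + s η * v i := by
      funext η; simp [shearDiffeo_apply]
    rw [this, partialDeriv, fderiv_fun_add (hasFDerivAt_coord i ξ).differentiableAt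
      (hs'.mul_const _), (hasFDerivAt_coord i ξ).fderiv, fderiv_mul_const hs']
    simp [partialDeriv]
  rw [det_fderiv_eq hd, Matrix.det_fin_three]
  simp only [Matrix.of_apply, he]
  rw [Fin.sum_univ_three] at h0
  simp only [Fin.isValue, ↓reduceIte, show ((0 : Fin 3) = 1) = False by decide,
    show ((0 : Fin 3) = 2) = False by decide, show ((1 : Fin 3) = 0) = False by decide,
    show ((1 : Fin 3) = 2) = False by decide, show ((2 : Fin 3) = 0) = False by decide,
    show ((2 : Fin 3) = 1) = False by decide]
  linear_combination h0

/-! ### Divergence-free fields as leading parts of shears -/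

/-- `IsShearJet k h` means that the homogeneous polynomial field `h` of degree `k` is the leading
part of a volume-preserving diffeomorphism tangent to the identity. -/
def IsShearJet (k : ℕ) (h : PolyMap) : Prop :=
  (∀ i, (h i).IsHomogeneous k) ∧ ∃ φ : E3 ≃ₘ[ℝ] E3, IsVolumePreserving φ ∧
    (fun ξ => φ ξ - ξ - h.toFun ξ) =O[𝓝 0] (fun ξ : E3 => ‖ξ‖ ^ (k + 1))

theorem PolyMap.toFun_apply (h : PolyMap) (ξ : E3) (i : Fin 3) :
    h.toFun ξ i = polyFun (h i) ξ := rfl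

theorem PolyMap.contDiff_toFun (h : PolyMap) : ContDiff ℝ ∞ h.toFun :=
  contDiff_euclidean.2 fun i => contDiff_polyFun (h i)

theorem PolyMap.isBigO_toFun {h : PolyMap} {k : ℕ} (hh : ∀ i, (h i).IsHomogeneous k) :
    h.toFun =O[𝓝 0] (fun ξ : E3 => ‖ξ‖ ^ k) :=
  isBigO_of_coord fun i => (hh i).vanishesToOrder.isBigO

theorem isBigO_id_pow_one : (fun ξ : E3 => ξ) =O[𝓝 0] (fun ξ : E3 => ‖ξ‖ ^ 1) := by
  simpa using (isBigO_refl (fun ξ : E3 => ξ) (𝓝 0)).norm_right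

theorem isShearJet_sub_id {k : ℕ} {h : PolyMap} (hh : ∀ i, (h i).IsHomogeneous k) {φ : E3 → E3}
    (hφ : (fun ξ => φ ξ - ξ - h.toFun ξ) =O[𝓝 0] (fun ξ : E3 => ‖ξ‖ ^ (k + 1))) :
    (fun ξ => φ ξ - ξ) =O[𝓝 0] (fun ξ : E3 => ‖ξ‖ ^ k) := by
  have := (hφ.trans (isBigO_norm_pow_of_le k.le_succ)).add (PolyMap.isBigO_toFun hh)
  exact this.congr_left fun ξ => by abel

theorem isBigO_one_of_sub_id {k : ℕ} (hk : 1 ≤ k) {φ : E3 → E3}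
    (hφ : (fun ξ => φ ξ - ξ) =O[𝓝 0] (fun ξ : E3 => ‖ξ‖ ^ k)) :
    φ =O[𝓝 0] (fun ξ : E3 => ‖ξ‖ ^ 1) := by
  have := (hφ.trans (isBigO_norm_pow_of_le hk)).add isBigO_id_pow_one
  exact this.congr_left fun ξ => by abel

/-- Leading parts of degree at least two add up under composition. -/
theorem IsShearJet.add {k : ℕ} (hk : 2 ≤ k) {h h' : PolyMap} (H : IsShearJet k h)
    (H' : IsShearJet k h') : IsShearJet k (h + h') := by
  obtain ⟨hh, φ, hφ, e⟩ := H
  obtain ⟨hh', φ', hφ', e'⟩ := H'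
  refine ⟨fun i => (hh i).add (hh' i), φ'.trans φ, hφ.comp hφ', ?_⟩
  have hO := isShearJet_sub_id hh' e'
  have hO1 := isBigO_one_of_sub_id (by omega) hO
  have h1 := isBigO_comp e hO1
  obtain ⟨m, rfl⟩ : ∃ m, k = m + 1 := ⟨k - 1, by omega⟩
  have h2 := isBigO_comp_sub_comp_vector h.contDiff_toFun (PolyMap.isBigO_toFun hh) hO1
    isBigO_id_pow_one hO
  have h3 := (h1.add (h2.trans (isBigO_norm_pow_of_le (by omega)))).add e'
  refine h3.congr_left fun ξ => ?_
  have : (h + h').toFun ξ = h.toFun ξ + h'.toFun ξ := by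
    ext i; simp [PolyMap.toFun_apply, polyFun]
  rw [this]
  simp only [Diffeomorph.coe_trans, Function.comp]
  abel

theorem isShearJet_of_shear {k : ℕ} (v : Fin 3 → ℝ) {σ : MvPolynomial (Fin 3) ℝ}
    (hσ : σ.IsHomogeneous k)
    (hinv : ∀ ξ (t : ℝ), polyFun σ (ξ + t • WithLp.toLp 2 v) = polyFun σ ξ) :
    IsShearJet k (fun i => C (v i) * σ) := by
  refine ⟨fun i => hσ.C_mul _, shearDiffeo (WithLp.toLp 2 v) (polyFun σ) (contDiff_polyFun σ) hinv,
    isVolumePreserving_shearDiffeo _ _ _ _, ?_⟩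
  refine (isBigO_zero _ _).congr_left fun ξ => ?_
  ext i
  simp [shearDiffeo_apply, PolyMap.toFun_apply, polyFun]
  ring

theorem isShearJet_zero (k : ℕ) : IsShearJet k 0 := by
  have := isShearJet_of_shear (k := k) 0 (isHomogeneous_zero (Fin 3) ℝ k) (by simp [polyFun])
  convert this using 1
  funext i; simp

theorem IsShearJet.sum {k : ℕ} (hk : 2 ≤ k) {ι : Type*} (s : Finset ι) {h : ι → PolyMap}
    (H : ∀ t ∈ s, IsShearJet k (h t)) : IsShearJet k (∑ t ∈ s, h t) := by
  classical
  induction s using Finset.induction_on with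
  | empty => simpa using isShearJet_zero k
  | insert a s ha ih =>
    rw [Finset.sum_insert ha]
    exact (H a (Finset.mem_insert_self _ _)).add hk
      (ih fun t ht => H t (Finset.mem_insert_of_mem ht))

/-- The divergence-free field `∂ⱼU eᵢ - ∂ᵢU eⱼ`: the Hamiltonian field of `U` in the coordinates
`i` and `j`, the remaining coordinate being a parameter. -/
noncomputable def hamiltonianField (i j : Fin 3) :
    MvPolynomial (Fin 3) ℝ →ₗ[ℝ] (Fin 3 → MvPolynomial (Fin 3) ℝ) where
  toFun U := Pi.single i (pderiv j U) - Pi.single j (pderiv i U)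
  map_add' U V := by simp only [map_add, Pi.single_add]; abel
  map_smul' c U := by
    simp only [Derivation.map_smul, Pi.single_smul, smul_sub, RingHom.id_apply]

theorem hamiltonianField_apply (i j : Fin 3) (U : MvPolynomial (Fin 3) ℝ) :
    hamiltonianField i j U = Pi.single i (pderiv j U) - Pi.single j (pderiv i U) := rfl

/-- A product of powers of two elements is a combination of powers of the sums `x + t y`. -/
theorem exists_pow_mul_pow_eq_sum {A : Type*} [CommRing A] [Algebra ℝ A] (x y : A) (a b : ℕ) :
    ∃ w : Fin (a + b + 1) → ℝ,
      x ^ a * y ^ b = ∑ t, w t • (x + ((t : ℕ) : ℝ) • y) ^ (a + b) := by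
  let V : Matrix (Fin (a + b + 1)) (Fin (a + b + 1)) ℝ := Matrix.vandermonde fun t => ((t : ℕ) : ℝ)
  have hV : IsUnit V.det := by
    refine isUnit_iff_ne_zero.2 (Matrix.det_vandermonde_ne_zero_iff.2 fun s t h => ?_)
    exact Fin.ext (by exact_mod_cast h)
  have hc : ((a + b).choose a : ℝ) ≠ 0 :=
    Nat.cast_ne_zero.2 (Nat.choose_pos (Nat.le_add_right a b)).ne'
  let β : Fin (a + b + 1) := ⟨b, by omega⟩
  let w : Fin (a + b + 1) → ℝ :=
    Matrix.vecMul (Pi.single β (((a + b).choose a : ℝ)⁻¹)) V⁻¹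
  have hw : Matrix.vecMul w V = Pi.single β (((a + b).choose a : ℝ)⁻¹) := by
    simp only [w, Matrix.vecMul_vecMul, Matrix.nonsing_inv_mul V hV, Matrix.vecMul_one]
  have hw' (l : ℕ) (hl : l ≤ a + b) : ∑ t : Fin (a + b + 1), w t * ((t : ℕ) : ℝ) ^ (a + b - l) =
      if l = a then ((a + b).choose a : ℝ)⁻¹ else 0 := by
    have := congrFun hw ⟨a + b - l, by omega⟩
    rw [Matrix.vecMul, dotProduct] at this
    simp only [V, Matrix.vandermonde_apply] at this
    rw [this, Pi.single_apply]
    refine if_congr ?_ rfl rfl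
    simp only [β, Fin.mk.injEq]
    omega
  refine ⟨w, ?_⟩
  simp only [add_pow, Finset.smul_sum]
  rw [Finset.sum_comm]
  rw [Finset.sum_eq_single a]
  · have := hw' a (by omega)
    rw [if_pos rfl] at this
    have e (t : Fin (a + b + 1)) : w t • (x ^ a * (((t : ℕ) : ℝ) • y) ^ (a + b - a) *
        ((a + b).choose a : A)) = (w t * ((t : ℕ) : ℝ) ^ (a + b - a)) •
          (((a + b).choose a : ℝ) • (x ^ a * y ^ b)) := by
      rw [smul_pow, Nat.add_sub_cancel_left, mul_smul, Algebra.smul_def (((a + b).choose a : ℝ))]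
      simp only [map_natCast, Algebra.smul_def]
      ring
    simp only [e]
    rw [← Finset.sum_smul, this, smul_smul, inv_mul_cancel₀ hc, one_smul]
  · intro l hl hla
    have := hw' l (by simpa [Nat.lt_succ_iff] using hl)
    rw [if_neg hla] at this
    have e (t : Fin (a + b + 1)) : w t • (x ^ l * (((t : ℕ) : ℝ) • y) ^ (a + b - l) *
        ((a + b).choose l : A)) = (w t * ((t : ℕ) : ℝ) ^ (a + b - l)) •
          ((((a + b).choose l : A)) * (x ^ l * y ^ (a + b - l))) := by
      rw [smul_pow, mul_smul]
      simp only [Algebra.smul_def]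
      ring
    simp only [e]
    rw [← Finset.sum_smul, this, zero_smul]
  · intro h
    exact absurd (Finset.mem_range.2 (by omega)) h

/-- The Hamiltonian field of `(xᵢ + t xⱼ) ^ n xₗ ^ e` is a shear along `t eᵢ - eⱼ`. -/
theorem isShearJet_hamiltonianField_pow {i j l : Fin 3} (hij : i ≠ j) (hil : i ≠ l) (hjl : j ≠ l)
    (t c : ℝ) (n e k : ℕ) (hk : n + e = k + 1) :
    IsShearJet k (hamiltonianField i j (c • ((X i + t • X j) ^ n * X l ^ e))) := by
  cases n with
  | zero =>
    have : hamiltonianField i j (c • ((X i + t • X j) ^ 0 * X l ^ e)) = 0 := by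
      rw [map_smul, hamiltonianField_apply]
      simp [pderiv_X_of_ne hil.symm, pderiv_X_of_ne hjl.symm, Derivation.leibniz_pow]
    rw [this]; exact isShearJet_zero k
  | succ n =>
    have h1 := isShearJet_of_shear (k := k) (Pi.single i t - Pi.single j 1)
      (σ := (c * (n + 1)) • ((X i + t • X j) ^ n * X l ^ e)) ?_ ?_
    · convert h1 using 1
      rw [map_smul, hamiltonianField_apply]
      funext m
      have dj : pderiv j ((X i + t • X j) ^ (n + 1) * X l ^ e : MvPolynomial (Fin 3) ℝ) =
          ((n + 1 : ℝ) * t) • ((X i + t • X j) ^ n * X l ^ e) := by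
        simp [pderiv_X_of_ne hij, pderiv_X_of_ne hjl.symm, Derivation.leibniz_pow,
          Derivation.leibniz, smul_eq_C_mul]
        ring
      have di : pderiv i ((X i + t • X j) ^ (n + 1) * X l ^ e : MvPolynomial (Fin 3) ℝ) =
          (n + 1 : ℝ) • ((X i + t • X j) ^ n * X l ^ e) := by
        simp [pderiv_X_of_ne hij.symm, pderiv_X_of_ne hil.symm, Derivation.leibniz_pow,
          Derivation.leibniz, smul_eq_C_mul]
        ring
      rw [di, dj]
      by_cases hmi : m = i
      · subst hmi
        simp [hij, smul_eq_C_mul]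
        ring
      · by_cases hmj : m = j
        · subst hmj
          simp [hij.symm, smul_eq_C_mul]
          ring
        · simp [hmi, hmj]
    · rw [smul_eq_C_mul]
      refine IsHomogeneous.C_mul ?_ _
      have hL : (X i + t • X j : MvPolynomial (Fin 3) ℝ).IsHomogeneous 1 := by
        rw [smul_eq_C_mul]
        exact (isHomogeneous_X _ _).add ((isHomogeneous_X _ _).C_mul _)
      have := (hL.pow n).mul ((isHomogeneous_X ℝ l).pow e)
      convert this using 1
      omega
    · intro ξ τ
      simp [polyFun, smul_eval, hij, hij.symm, hil.symm, hjl.symm]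
      left; left
      ring

theorem isShearJet_hamiltonianField {i j l : Fin 3} (hij : i ≠ j) (hil : i ≠ l) (hjl : j ≠ l)
    {k : ℕ} (hk : 2 ≤ k) {U : MvPolynomial (Fin 3) ℝ} (hU : U.IsHomogeneous (k + 1)) :
    IsShearJet k (hamiltonianField i j U) := by
  have huniv : (Finset.univ : Finset (Fin 3)) = {i, j, l} := by
    revert i j l; decide
  rw [U.as_sum, map_sum]
  refine IsShearJet.sum hk _ fun s hs => ?_
  have hdeg := hU.degree_eq_of_mem_support hs
  rw [Finsupp.degree_eq_sum, huniv, Finset.sum_insert (by simp [hij, hil]),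
    Finset.sum_insert (by simp [hjl]), Finset.sum_singleton] at hdeg
  have hmon : monomial s (coeff s U) = coeff s U • (X i ^ s i * X j ^ s j * X l ^ s l) := by
    rw [monomial_eq, Finsupp.prod_fintype _ _ (by simp), huniv,
      Finset.prod_insert (by simp [hij, hil]), Finset.prod_insert (by simp [hjl]),
      Finset.prod_singleton, smul_eq_C_mul]
    ring
  obtain ⟨w, hw⟩ := exists_pow_mul_pow_eq_sum (X i : MvPolynomial (Fin 3) ℝ) (X j) (s i) (s j)
  rw [hmon, hw, Finset.sum_mul, Finset.smul_sum, map_sum]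
  refine IsShearJet.sum hk _ fun t _ => ?_
  rw [smul_mul_assoc, smul_smul]
  exact isShearJet_hamiltonianField_pow hij hil hjl _ _ _ _ _ (by omega)

theorem pderiv_pderiv_comm {σ R : Type*} [CommRing R] (i j : σ) (p : MvPolynomial σ R) :
    pderiv i (pderiv j p) = pderiv j (pderiv i p) := by
  classical
  have h : ⁅pderiv (R := R) i, pderiv (R := R) j⁆ = 0 := by
    refine derivation_ext fun l => ?_
    rw [Derivation.commutator_apply, pderiv_X, pderiv_X]
    simp only [Pi.single_apply]
    split_ifs <;> simp
  have := DFunLike.congr_fun h p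
  rw [Derivation.commutator_apply] at this
  exact sub_eq_zero.1 this

theorem exists_rename_of_pderiv_two {k : ℕ} {c : MvPolynomial (Fin 3) ℝ} (hc : c.IsHomogeneous k)
    (h : pderiv 2 c = 0) :
    ∃ r : MvPolynomial (Fin 2) ℝ, r.IsHomogeneous k ∧ rename ![0, 1] r = c := by
  have hinj : Function.Injective (![0, 1] : Fin 2 → Fin 3) := by decide
  obtain ⟨r, hr⟩ := exists_rename_eq_of_vars_subset_range c ![0, 1] hinj (by
    intro i hi
    rw [Finset.mem_coe, mem_vars_iff_mem_support] at hi
    obtain ⟨s, hs, his⟩ := hi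
    have h2 : s 2 = 0 := by
      by_contra h0
      have := congrArg (coeff (s - Finsupp.single 2 1)) h
      rw [coeff_pderiv, Finsupp.sub_add_single_one_cancel h0, coeff_zero] at this
      have h3 : (((s - Finsupp.single 2 1 : Fin 3 →₀ ℕ) 2 : ℕ) : ℝ) + 1 ≠ 0 := by positivity
      exact (mul_ne_zero (mem_support_iff.1 hs) h3) this
    fin_cases i
    · exact ⟨0, rfl⟩
    · exact ⟨1, rfl⟩
    · exact absurd h2 (by simpa using his))
  refine ⟨r, ?_, hr⟩
  rw [← IsHomogeneous.rename_isHomogeneous_iff hinj, hr]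
  exact hc

theorem polyFun_rename (r : MvPolynomial (Fin 2) ℝ) (ξ : E3) :
    polyFun (rename ![0, 1] r) ξ = eval ![ξ 0, ξ 1] r := by
  rw [polyFun, eval_rename]
  congr 2
  funext i
  fin_cases i <;> rfl

/-- Every homogeneous divergence-free field of degree at least two is the leading part of a
composition of shears. -/
theorem isShearJet_of_divergence_eq_zero {k : ℕ} (hk : 2 ≤ k) {h : PolyMap}
    (hh : ∀ i, (h i).IsHomogeneous k) (hdiv : ∑ i, pderiv i (h i) = 0) : IsShearJet k h := by
  -- two Hamiltonian fields absorb the first two components of `h`, and the rest of the third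
  -- component is independent of `z`
  obtain ⟨U, hU, eU⟩ := (hh 0).exists_pderiv_eq 1
  obtain ⟨W, hW, eW⟩ := ((hh 1).add (hU.pderiv (i := 0))).exists_pderiv_eq 2
  set c := h 2 + pderiv 1 W with hc
  have hch : c.IsHomogeneous k := (hh 2).add hW.pderiv
  have hc2 : pderiv 2 c = 0 := by
    rw [hc, map_add, pderiv_pderiv_comm 2 1 W, eW, map_add, pderiv_pderiv_comm 1 0 U, eU, ← hdiv,
      Fin.sum_univ_three]
    ring
  obtain ⟨r, hr, hrc⟩ := exists_rename_of_pderiv_two hch hc2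
  have h1 := isShearJet_of_shear (Pi.single 2 1) hch (by
    intro ξ t
    rw [← hrc, polyFun_rename, polyFun_rename]
    simp)
  have h2 := ((isShearJet_hamiltonianField (i := 0) (j := 1) (l := 2) (by decide) (by decide)
    (by decide) hk hU).add hk (isShearJet_hamiltonianField (i := 1) (j := 2) (l := 0) (by decide)
    (by decide) (by decide) hk hW)).add hk h1
  convert h2 using 1
  funext i
  fin_cases i
  · simp [hamiltonianField_apply, eU]
  · simp [hamiltonianField_apply, eW]
  · simp [hamiltonianField_apply, hc]

/-! ### One normalization step -/

theorem shearMap_zero (q : MvPolynomial (Fin 2) ℝ) : shearMap q 0 = X 0 + X 1 := by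
  simp [shearMap, jordanJ, jordanN, Fin.sum_univ_three]

theorem shearMap_one (q : MvPolynomial (Fin 2) ℝ) :
    shearMap q 1 = X 1 + X 2 + rename ![0, 1] q := by
  simp [shearMap, jordanJ, jordanN, Fin.sum_univ_three]
  ring

theorem shearMap_two (q : MvPolynomial (Fin 2) ℝ) : shearMap q 2 = X 2 + rename ![0, 1] q := by
  simp [shearMap, jordanJ, jordanN, Fin.sum_univ_three]

theorem shearMap_toFun_zero (q : MvPolynomial (Fin 2) ℝ) (ξ : E3) :
    (shearMap q).toFun ξ 0 = ξ 0 + ξ 1 := by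
  simp [PolyMap.toFun_apply, shearMap_zero, polyFun]

theorem shearMap_toFun_one (q : MvPolynomial (Fin 2) ℝ) (ξ : E3) :
    (shearMap q).toFun ξ 1 = ξ 1 + ξ 2 + polyFun (rename ![0, 1] q) ξ := by
  simp [PolyMap.toFun_apply, shearMap_one, polyFun]

theorem shearMap_toFun_two (q : MvPolynomial (Fin 2) ℝ) (ξ : E3) :
    (shearMap q).toFun ξ 2 = ξ 2 + polyFun (rename ![0, 1] q) ξ := by
  simp [PolyMap.toFun_apply, shearMap_two, polyFun]

theorem IsVolumePreserving.trans {f g : E3 ≃ₘ[ℝ] E3} (hf : IsVolumePreserving f)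
    (hg : IsVolumePreserving g) : IsVolumePreserving (f.trans g) :=
  hg.comp hf

theorem eq_zero_of_isBigO_pow_succ {E : Type*} [NormedAddCommGroup E] {f : E3 → E} {k : ℕ}
    (h : f =O[𝓝 0] (fun ξ : E3 => ‖ξ‖ ^ (k + 1))) : f 0 = 0 := by
  obtain ⟨c, hc⟩ := h.bound
  simpa using hc.self_of_nhds

/-- The map `J (ξ + ê₃ q(x, y))` is a composition of three shears, since `J` is the product of two
elementary matrices. -/
theorem exists_diffeo_shearMap (q : MvPolynomial (Fin 2) ℝ) :
    ∃ G : E3 ≃ₘ[ℝ] E3, IsVolumePreserving G ∧ ∀ ξ, G ξ = (shearMap q).toFun ξ := by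
  have h1 : ∀ (ξ : E3) (t : ℝ), polyFun (rename ![0, 1] q) (ξ + t • EuclideanSpace.single 2 1) =
      polyFun (rename ![0, 1] q) ξ := by
    intro ξ t
    rw [polyFun_rename, polyFun_rename]
    simp
  let A := shearDiffeo (EuclideanSpace.single 2 1) _ (contDiff_polyFun (rename ![0, 1] q)) h1
  let B := shearDiffeo (EuclideanSpace.single 0 1) _ (contDiff_coord 1)
    (by intro ξ t; simp)
  let C := shearDiffeo (EuclideanSpace.single 1 1) _ (contDiff_coord 2)
    (by intro ξ t; simp)
  have hA : IsVolumePreserving A := isVolumePreserving_shearDiffeo _ _ _ _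
  have hB : IsVolumePreserving B := isVolumePreserving_shearDiffeo _ _ _ _
  have hC : IsVolumePreserving C := isVolumePreserving_shearDiffeo _ _ _ _
  refine ⟨(A.trans B).trans C, (hA.trans hB).trans hC, ?_⟩
  intro ξ
  ext i
  fin_cases i
  · simp [A, B, C, shearDiffeo_apply, shearMap_toFun_zero]
  · simp [A, B, C, shearDiffeo_apply, shearMap_toFun_one]
    ring
  · simp [A, B, C, shearDiffeo_apply, shearMap_toFun_two]

/-- The leading part of a volume-preserving diffeomorphism close to the identity is
divergence-free. -/
theorem exists_leading_part {k : ℕ} (hk : 2 ≤ k) {K : E3 ≃ₘ[ℝ] E3} (hK : IsVolumePreserving K)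
    (h : (fun ξ => K ξ - ξ) =O[𝓝 0] (fun ξ : E3 => ‖ξ‖ ^ k)) :
    ∃ S : PolyMap, (∀ i, (S i).IsHomogeneous k) ∧ ∑ i, pderiv i (S i) = 0 ∧
      (fun ξ => K ξ - ξ - S.toFun ξ) =O[𝓝 0] (fun ξ : E3 => ‖ξ‖ ^ (k + 1)) := by
  obtain ⟨m, rfl⟩ : ∃ m, k = m + 1 := ⟨k - 1, by omega⟩
  have hsm (i : Fin 3) : ContDiff ℝ ∞ (fun ξ => K ξ i) := contDiff_euclidean.1 K.contDiff i
  have hsm' (i : Fin 3) : ContDiff ℝ ∞ (fun ξ => (K ξ - ξ) i) :=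
    contDiff_euclidean.1 (K.contDiff.sub contDiff_id) i
  choose S hS hS' using fun i =>
    (VanishesToOrder.of_isBigO (hsm' i) (isBigO_coord h i)).exists_taylor
  refine ⟨S, hS, ?_, isBigO_of_coord fun i => (hS' i).isBigO⟩
  set e : Fin 3 → Fin 3 → E3 → ℝ := fun i j => partialDeriv j (fun ξ => (K ξ - ξ) i) with he
  have heO (i j : Fin 3) : e i j =O[𝓝 0] (fun ξ : E3 => ‖ξ‖ ^ m) :=
    isBigO_partialDeriv (hsm' i) (isBigO_coord h i) j
  have hKe (i j : Fin 3) (ξ : E3) : partialDeriv j (fun ξ => K ξ i) ξ =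
      (if i = j then 1 else 0) + e i j ξ := by
    have h1 : (fun ξ => (K ξ - ξ) i) = (fun ξ => K ξ i) - (fun ξ => ξ i) := by funext ξ; simp
    have h2 : partialDeriv j (fun ξ : E3 => ξ i) ξ = if i = j then 1 else 0 := by
      rw [partialDeriv, (hasFDerivAt_coord i ξ).fderiv]
      simp
    rw [he]
    simp only
    rw [h1, partialDeriv_sub (hsm i) (contDiff_coord i), Pi.sub_apply, h2]
    ring
  -- expanding `det (1 + e) = 1`, the trace of `e` equals a sum of products of entries of `e`
  have htr : (fun ξ => e 0 0 ξ + e 1 1 ξ + e 2 2 ξ) =O[𝓝 0] (fun ξ : E3 => ‖ξ‖ ^ (m + 1)) := by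
    have hmul (i j k l : Fin 3) : (fun ξ => e i j ξ * e k l ξ) =O[𝓝 0]
        (fun ξ : E3 => ‖ξ‖ ^ (m + 1)) := by
      refine ((heO i j).mul (heO k l)).trans ?_
      simp only [← pow_add]
      exact isBigO_norm_pow_of_le (by omega)
    have hmul3 (i j k l i' j' : Fin 3) : (fun ξ => e i' j' ξ * (e i j ξ * e k l ξ)) =O[𝓝 0]
        (fun ξ : E3 => ‖ξ‖ ^ (m + 1)) := by
      refine ((heO i' j').mul (hmul i j k l)).trans ?_
      simp only [← pow_add]
      exact isBigO_norm_pow_of_le (by omega)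
    have hsum := ((((((((hmul 0 1 1 0).sub (hmul 0 0 1 1)).add (hmul 0 2 2 0)).sub
      (hmul 0 0 2 2)).add (hmul 1 2 2 1)).sub (hmul 1 1 2 2)).sub
      ((hmul3 1 1 2 2 0 0).sub (hmul3 1 2 2 1 0 0))).add
      ((hmul3 1 0 2 2 0 1).sub (hmul3 1 2 2 0 0 1))).sub
      ((hmul3 1 0 2 1 0 2).sub (hmul3 1 1 2 0 0 2))
    refine hsum.congr_left fun ξ => ?_
    have hdet := hK.2 ξ
    rw [det_fderiv_eq hK.1, Matrix.det_fin_three] at hdet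
    simp only [Matrix.of_apply, hKe] at hdet
    simp only [Fin.isValue, ↓reduceIte, show ((0 : Fin 3) = 1) = False by decide,
      show ((0 : Fin 3) = 2) = False by decide, show ((1 : Fin 3) = 0) = False by decide,
      show ((1 : Fin 3) = 2) = False by decide, show ((2 : Fin 3) = 0) = False by decide,
      show ((2 : Fin 3) = 1) = False by decide] at hdet
    linear_combination -hdet
  refine IsHomogeneous.eq_zero_of_isBigO (k := m)
    (IsHomogeneous.sum _ _ _ fun i _ => (hS i).pderiv) ?_
  have hi (i : Fin 3) : (fun ξ => e i i ξ - polyFun (pderiv i (S i)) ξ) =O[𝓝 0]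
      (fun ξ : E3 => ‖ξ‖ ^ (m + 1)) := by
    refine ((hS' i).2.2 i).isBigO.congr_left fun ξ => ?_
    rw [partialDeriv_sub (hsm' i) (contDiff_polyFun _), partialDeriv_polyFun]
    rfl
  refine (htr.sub (((hi 0).add (hi 1)).add (hi 2))).congr_left fun ξ => ?_
  simp only [Fin.sum_univ_three, polyFun, map_add]
  ring

theorem polyFun_jordanSubst (p : MvPolynomial (Fin 3) ℝ) (ξ : E3) :
    polyFun (jordanSubst p) ξ = polyFun p ((shearMap 0).toFun ξ) := by
  induction p using MvPolynomial.induction_on with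
  | C a => simp [polyFun, jordanSubst]
  | add p q hp hq =>
    simp only [polyFun, map_add] at hp hq ⊢
    rw [hp, hq]
  | mul_X p i hp =>
    simp only [polyFun, map_mul, eval_X] at hp ⊢
    rw [hp]
    congr 1
    fin_cases i
    · simp [jordanSubst, shearMap_toFun_zero]
    · simp [jordanSubst, shearMap_toFun_one, polyFun]
    · simp [jordanSubst, shearMap_toFun_two, polyFun]

/-- One step of the normalization: a map agreeing with a normal form up to order `k` is conjugated
by a near-identity volume-preserving diffeomorphism to one which agrees with a normal form up to
order `k + 1`. -/
theorem exists_normalization_step {k : ℕ} (hk : 2 ≤ k) {q : MvPolynomial (Fin 2) ℝ}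
    (hq : polyFun (rename ![0, 1] q) =O[𝓝 0] (fun ξ : E3 => ‖ξ‖ ^ 2))
    {F : E3 ≃ₘ[ℝ] E3} (hF : IsVolumePreserving F) (hF0 : F 0 = 0)
    (hFq : (fun ξ => F ξ - (shearMap q).toFun ξ) =O[𝓝 0] (fun ξ : E3 => ‖ξ‖ ^ k)) :
    ∃ (r : MvPolynomial (Fin 2) ℝ) (φ : E3 ≃ₘ[ℝ] E3), r.IsHomogeneous k ∧ IsVolumePreserving φ ∧
      (fun ξ => φ ξ - ξ) =O[𝓝 0] (fun ξ : E3 => ‖ξ‖ ^ k) ∧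
      (fun ξ => φ (F ξ) - (shearMap (q + r)).toFun (φ ξ)) =O[𝓝 0]
        (fun ξ : E3 => ‖ξ‖ ^ (k + 1)) := by
  obtain ⟨G, hG, hGq⟩ := exists_diffeo_shearMap q
  have hq0 : polyFun (rename ![0, 1] q) 0 = 0 := eq_zero_of_isBigO_pow_succ (k := 1) hq
  have hG0 : G 0 = 0 := by
    rw [hGq]
    ext i
    fin_cases i
    · simp [shearMap_toFun_zero]
    · simp [shearMap_toFun_one, hq0]
    · simp [shearMap_toFun_two, hq0]
  have hGs0 : G.symm 0 = 0 := by
    simpa [hG0] using G.symm_apply_apply 0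
  have hF1 := isBigO_one_of_contDiff F.contDiff hF0
  have hG1 := isBigO_one_of_contDiff G.contDiff hG0
  have hGs1 := isBigO_one_of_contDiff G.symm.contDiff hGs0
  simp only [← hGq] at hFq
  -- `F = G ∘ K` with `K` close to the identity
  set K : E3 ≃ₘ[ℝ] E3 := F.trans G.symm with hKdef
  have hK : IsVolumePreserving K := hF.trans hG.symm
  have hGK (ξ : E3) : F ξ = G (K ξ) := by simp [hKdef]
  have hKid : (fun ξ => K ξ - ξ) =O[𝓝 0] (fun ξ : E3 => ‖ξ‖ ^ k) := by
    have := isBigO_comp_sub_comp_vector (m := 0) G.symm.contDiff hGs1 hF1 hG1 hFq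
    refine this.congr_left fun ξ => ?_
    simp [hKdef]
  obtain ⟨S, hS, hdiv, hSO⟩ := exists_leading_part hk hK hKid
  obtain ⟨n, rfl⟩ : ∃ n, k = n + 1 := ⟨k - 1, by omega⟩
  obtain ⟨h, c, hh, hdivh, hc, hc2, e0, e1, e2⟩ := exists_homological_solution hS hdiv
  obtain ⟨r, hr, rfl⟩ := exists_rename_of_pderiv_two hc hc2
  obtain ⟨-, φ, hφ, hφO⟩ := isShearJet_of_divergence_eq_zero hk hh hdivh
  have hφid := isShearJet_sub_id hh hφO
  have hφ1 := isBigO_one_of_sub_id (by omega) hφid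
  have hK1 := isBigO_one_of_sub_id (by omega) hKid
  refine ⟨r, φ, hr, hφ, hφid, ?_⟩
  have hqr : polyFun (rename ![0, 1] (q + r)) =O[𝓝 0] (fun ξ : E3 => ‖ξ‖ ^ (1 + 1)) := by
    have h1 := hq.add (hc.vanishesToOrder.isBigO.trans (isBigO_norm_pow_of_le hk))
    exact h1.congr_left fun ξ => by simp [polyFun]
  have hJ1 : (shearMap 0).toFun =O[𝓝 0] (fun ξ : E3 => ‖ξ‖ ^ 1) :=
    isBigO_one_of_contDiff (PolyMap.contDiff_toFun _) (by
      ext i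
      fin_cases i
      · simp [shearMap_toFun_zero]
      · simp [shearMap_toFun_one, polyFun]
      · simp [shearMap_toFun_two, polyFun])
  have hFJ : (fun ξ => F ξ - (shearMap 0).toFun ξ) =O[𝓝 0] (fun ξ : E3 => ‖ξ‖ ^ 2) := by
    have h1 := hFq.trans (isBigO_norm_pow_of_le hk)
    have h2 : (fun ξ => G ξ - (shearMap 0).toFun ξ) =O[𝓝 0] (fun ξ : E3 => ‖ξ‖ ^ 2) := by
      refine isBigO_of_coord fun i => ?_
      simp only [hGq, PiLp.sub_apply]
      fin_cases i
      · refine (isBigO_zero _ _).congr_left fun ξ => ?_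
        simp [shearMap_toFun_zero]
      · refine hq.congr_left fun ξ => ?_
        simp [shearMap_toFun_one, polyFun]
      · refine hq.congr_left fun ξ => ?_
        simp [shearMap_toFun_two, polyFun]
    exact (h1.add h2).congr_left fun ξ => by abel
  have o1 (i : Fin 3) := isBigO_coord (isBigO_comp hφO hF1) i
  have o2 (i : Fin 3) : (fun ξ => polyFun (h i) (F ξ) - polyFun (jordanSubst (h i)) ξ) =O[𝓝 0]
      (fun ξ : E3 => ‖ξ‖ ^ (n + 1 + 1)) := by
    have h1 := isBigO_comp_sub_comp (m := n) (contDiff_polyFun (h i))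
      (hh i).vanishesToOrder.isBigO hF1 hJ1 hFJ
    refine (h1.trans (isBigO_norm_pow_of_le (by omega))).congr_left fun ξ => ?_
    rw [polyFun_jordanSubst]
  have o3 (i : Fin 3) := isBigO_coord hSO i
  have o4 := isBigO_comp_sub_comp (m := 1) (contDiff_polyFun _) hq hK1 isBigO_id_pow_one hKid
  have o5 (i : Fin 3) := isBigO_coord hφO i
  have o6 := isBigO_comp_sub_comp (m := 1) (contDiff_polyFun _) hqr hφ1 isBigO_id_pow_one hφid
  -- in each coordinate the degree `k` terms cancel by the homological equation
  refine isBigO_of_coord fun i => ?_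
  have eqr (ξ : E3) : polyFun (rename ![0, 1] (q + r)) ξ =
      polyFun (rename ![0, 1] q) ξ + polyFun (rename ![0, 1] r) ξ := by simp [polyFun]
  fin_cases i
  · refine (((((o1 0).add (o2 0)).add (o3 0)).add (o3 1)).sub ((o5 0).add (o5 1))).congr_left
      fun ξ => ?_
    have a0 := congrArg (fun p => polyFun p ξ) e0
    have a1 := congrArg (fun p => polyFun p ξ) e1
    have b := congrArg (fun v => v 0) (hGK ξ)
    simp only [hGq, shearMap_toFun_zero, PiLp.sub_apply, Fin.zero_eta] at b ⊢
    simp only [PolyMap.toFun_apply, polyFun, map_add, map_sub] at a0 a1 b ⊢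
    linear_combination -b - a0 - a1
  · refine (((((((o1 1).add (o2 1)).add (o3 1)).add (o3 2)).add o4).sub
      ((o5 1).add (o5 2))).sub o6).congr_left fun ξ => ?_
    have a1 := congrArg (fun p => polyFun p ξ) e1
    have a2 := congrArg (fun p => polyFun p ξ) e2
    have b := congrArg (fun v => v 1) (hGK ξ)
    simp only [hGq, shearMap_toFun_one, PiLp.sub_apply, Fin.mk_one, eqr] at b ⊢
    simp only [PolyMap.toFun_apply, polyFun, map_add, map_sub] at a1 a2 b ⊢
    linear_combination -b - a1 - a2
  · refine ((((((o1 2).add (o2 2)).add (o3 2)).add o4).sub (o5 2)).sub o6).congr_left fun ξ => ?_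
    have a2 := congrArg (fun p => polyFun p ξ) e2
    have b := congrArg (fun v => v 2) (hGK ξ)
    simp only [hGq, shearMap_toFun_two, PiLp.sub_apply, Fin.reduceFinMk, eqr] at b ⊢
    simp only [PolyMap.toFun_apply, polyFun, map_add, map_sub] at a2 b ⊢
    linear_combination -b - a2

/-! ### The polynomial inverse and its degree -/

theorem totalDegree_le_of_isHomogeneous_map
    {L : MvPolynomial (Fin 3) ℝ →ₐ[ℝ] MvPolynomial (Fin 3) ℝ}
    (hL : ∀ (k : ℕ) (u : MvPolynomial (Fin 3) ℝ), u.IsHomogeneous k → (L u).IsHomogeneous k)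
    (p : MvPolynomial (Fin 3) ℝ) : (L p).totalDegree ≤ p.totalDegree := by
  conv_lhs => rw [← sum_homogeneousComponent p, map_sum]
  refine (totalDegree_finsetSum _ _).trans (Finset.sup_le fun i hi => ?_)
  exact (hL i _ (homogeneousComponent_isHomogeneous i p)).totalDegree_le.trans
    (Nat.lt_succ_iff.1 (Finset.mem_range.1 hi))

theorem totalDegree_jordanSubstInv (p : MvPolynomial (Fin 3) ℝ) :
    (jordanSubstInv p).totalDegree = p.totalDegree := by
  refine le_antisymm (totalDegree_le_of_isHomogeneous_map (fun _ _ h => h.jordanSubstInv) p) ?_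
  conv_lhs => rw [← jordanSubst_jordanSubstInv p]
  exact totalDegree_le_of_isHomogeneous_map (fun _ _ h => h.jordanSubst) _

theorem two_le_totalDegree_rename {q : MvPolynomial (Fin 2) ℝ}
    (hq : ∀ s ∈ q.support, 2 ≤ s.degree) (hq0 : q ≠ 0) :
    2 ≤ (rename (![0, 1] : Fin 2 → Fin 3) q).totalDegree := by
  obtain ⟨s, hs⟩ := support_nonempty.2 hq0
  have hinj : Function.Injective (![0, 1] : Fin 2 → Fin 3) := by decide
  have h1 : s.mapDomain ![0, 1] ∈ (rename (![0, 1] : Fin 2 → Fin 3) q).support := by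
    rw [mem_support_iff, coeff_rename_mapDomain _ hinj]
    exact mem_support_iff.1 hs
  have h2 := le_totalDegree h1
  have h3 : (s.mapDomain (![0, 1] : Fin 2 → Fin 3)).degree = s.degree := by
    simp [Finsupp.degree_mapDomain]
  have h4 := hq s hs
  rw [← h3] at h4
  exact h4.trans h2

/-- The degree of a triple whose last component `X₂ + P` dominates the other two. -/
theorem PolyMap.degree_eq {G : PolyMap} {P : MvPolynomial (Fin 3) ℝ}
    (hP : P = 0 ∨ 2 ≤ P.totalDegree) (h0 : (G 0).totalDegree ≤ 1)
    (h1 : (G 1).totalDegree ≤ max 1 P.totalDegree) (h2 : G 2 = X 2 + P) :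
    G.degree = max 1 P.totalDegree := by
  have h2' : (G 2).totalDegree = max 1 P.totalDegree := by
    rw [h2]
    rcases hP with rfl | hP
    · simp
    · rw [totalDegree_add_eq_right_of_totalDegree_lt (by rw [totalDegree_X]; omega)]
      omega
  refine le_antisymm (Finset.sup_le fun i _ => ?_) ?_
  · fin_cases i
    · exact h0.trans (le_max_left _ _)
    · exact h1
    · exact h2'.le
  · rw [← h2']
    exact Finset.le_sup (f := fun i => (G i).totalDegree) (Finset.mem_univ 2)

theorem totalDegree_X_add_X_le (i j : Fin 3) :
    (X i + X j : MvPolynomial (Fin 3) ℝ).totalDegree ≤ 1 := by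
  refine (totalDegree_add _ _).trans ?_
  simp

theorem totalDegree_X_sub_X_le (i j : Fin 3) :
    (X i - X j : MvPolynomial (Fin 3) ℝ).totalDegree ≤ 1 := by
  refine (totalDegree_sub _ _).trans ?_
  simp

/-- The inverse of `ξ ↦ J (ξ + ê₃ q(x, y))`. -/
noncomputable def shearMapInv (q : MvPolynomial (Fin 2) ℝ) : PolyMap :=
  ![X 0 - X 1 + X 2, X 1 - X 2, X 2 - jordanSubstInv (rename ![0, 1] q)]

theorem polyFun_jordanSubstInv_rename (q : MvPolynomial (Fin 2) ℝ) (ξ : E3) :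
    polyFun (jordanSubstInv (rename ![0, 1] q)) ξ = eval ![ξ 0 - ξ 1 + ξ 2, ξ 1 - ξ 2] q := by
  induction q using MvPolynomial.induction_on with
  | C a => simp [polyFun]
  | add p q hp hq =>
    simp only [polyFun, map_add] at hp hq ⊢
    rw [hp, hq]
  | mul_X p i hp =>
    simp only [polyFun, map_mul, eval_X, rename_X] at hp ⊢
    rw [hp]
    congr 1
    fin_cases i <;> simp [jordanSubstInv]

theorem shearMapInv_toFun (q : MvPolynomial (Fin 2) ℝ) (ξ : E3) :
    (shearMapInv q).toFun ξ = WithLp.toLp 2 ![ξ 0 - ξ 1 + ξ 2, ξ 1 - ξ 2,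
      ξ 2 - eval ![ξ 0 - ξ 1 + ξ 2, ξ 1 - ξ 2] q] := by
  rw [← polyFun_jordanSubstInv_rename]
  ext i
  fin_cases i <;> simp [PolyMap.toFun_apply, shearMapInv, polyFun]

theorem leftInverse_shearMapInv (q : MvPolynomial (Fin 2) ℝ) :
    Function.LeftInverse (shearMapInv q).toFun (shearMap q).toFun := by
  intro ξ
  rw [shearMapInv_toFun, shearMap_toFun_zero, shearMap_toFun_one, shearMap_toFun_two,
    polyFun_rename]
  have e0 : ξ 0 + ξ 1 - (ξ 1 + ξ 2 + eval ![ξ 0, ξ 1] q) + (ξ 2 + eval ![ξ 0, ξ 1] q) = ξ 0 := by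
    ring
  have e1 : ξ 1 + ξ 2 + eval ![ξ 0, ξ 1] q - (ξ 2 + eval ![ξ 0, ξ 1] q) = ξ 1 := by ring
  rw [e0, e1]
  ext i
  fin_cases i <;> simp

theorem rightInverse_shearMapInv (q : MvPolynomial (Fin 2) ℝ) :
    Function.RightInverse (shearMapInv q).toFun (shearMap q).toFun := by
  intro ξ
  rw [shearMapInv_toFun]
  ext i
  fin_cases i
  · simp [shearMap_toFun_zero]
  · simp [shearMap_toFun_one, polyFun_rename]
  · simp [shearMap_toFun_two, polyFun_rename]

theorem degree_shearMapInv {q : MvPolynomial (Fin 2) ℝ} (hq : ∀ s ∈ q.support, 2 ≤ s.degree) :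
    (shearMapInv q).degree = (shearMap q).degree := by
  set P := rename (![0, 1] : Fin 2 → Fin 3) q with hPdef
  have hP : P = 0 ∨ 2 ≤ P.totalDegree := by
    by_cases h : q = 0
    · exact Or.inl (by rw [hPdef, h, map_zero])
    · exact Or.inr (two_le_totalDegree_rename hq h)
  have hP' : -jordanSubstInv P = 0 ∨ 2 ≤ (-jordanSubstInv P).totalDegree := by
    rw [totalDegree_neg, totalDegree_jordanSubstInv]
    exact hP.imp_left fun h => by simp [h]
  rw [PolyMap.degree_eq (G := shearMap q) hP, PolyMap.degree_eq (G := shearMapInv q) hP',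
    totalDegree_neg, totalDegree_jordanSubstInv]
  · refine (totalDegree_add _ _).trans (max_le (totalDegree_X_sub_X_le 0 1) ?_)
    simp
  · exact (totalDegree_X_sub_X_le 1 2).trans (le_max_left _ _)
  · simp [shearMapInv, hPdef, sub_eq_add_neg]
  · rw [shearMap_zero]; exact totalDegree_X_add_X_le 0 1
  · rw [shearMap_one]
    exact (totalDegree_add _ _).trans (max_le_max (totalDegree_X_add_X_le 1 2) le_rfl)
  · exact shearMap_two q

theorem isVolumePreserving_shearMap (q : MvPolynomial (Fin 2) ℝ) :
    IsVolumePreserving (shearMap q).toFun := by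
  obtain ⟨G, hG, hGq⟩ := exists_diffeo_shearMap q
  rwa [← funext hGq]

/-! ### Construction of the formal normal form -/

theorem isBigO_polyFun_rename {q : MvPolynomial (Fin 2) ℝ}
    (hq : ∀ s ∈ q.support, 2 ≤ s.degree) :
    polyFun (rename ![0, 1] q) =O[𝓝 0] (fun ξ : E3 => ‖ξ‖ ^ 2) := by
  have h1 : polyFun (rename ![0, 1] q) =
      fun ξ => ∑ s ∈ q.support, polyFun (rename ![0, 1] (monomial s (coeff s q))) ξ := by
    funext ξ
    conv_lhs => rw [q.as_sum]
    simp only [polyFun, map_sum]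
  rw [h1]
  refine IsBigO.fun_sum fun s hs => ?_
  exact ((isHomogeneous_monomial _ rfl).rename_isHomogeneous.vanishesToOrder.isBigO).trans
    (isBigO_norm_pow_of_le (hq s hs))

/-- `IsNormalizedBy f d q ψ` means that `ψ` is a near-identity volume-preserving diffeomorphism
conjugating `f` to `J (ξ + ê₃ q(x, y))` up to terms of order `d + 1`, where `q` has only terms of
degree between `2` and `d`. -/
structure IsNormalizedBy (f : E3 ≃ₘ[ℝ] E3) (d : ℕ) (q : MvPolynomial (Fin 2) ℝ)
    (ψ : E3 ≃ₘ[ℝ] E3) : Prop where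
  degree_mem : ∀ s ∈ q.support, 2 ≤ s.degree ∧ s.degree ≤ d
  volume : IsVolumePreserving ψ
  near : IsNearIdentity ψ
  conj : (fun ξ => ψ (f ξ) - (shearMap q).toFun (ψ ξ)) =O[𝓝 0] (fun ξ : E3 => ‖ξ‖ ^ (d + 1))

theorem isNormalizedBy_one {f : E3 ≃ₘ[ℝ] E3} (hfix : f 0 = 0)
    (hlin : fderiv ℝ f 0 = Matrix.toEuclideanCLM (n := Fin 3) (𝕜 := ℝ) jordanJ) :
    IsNormalizedBy f 1 0 (Diffeomorph.refl _ E3 ∞) := by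
  refine ⟨by simp, isVolumePreserving_id, (isBigO_zero _ _).congr_left fun ξ => by simp, ?_⟩
  have hJ (ξ : E3) : (shearMap 0).toFun ξ =
      Matrix.toEuclideanCLM (n := Fin 3) (𝕜 := ℝ) jordanJ ξ := by
    ext i
    have : (Matrix.toEuclideanCLM (n := Fin 3) (𝕜 := ℝ) jordanJ ξ) i =
      (jordanJ.mulVec (WithLp.ofLp ξ)) i := rfl
    rw [this]
    fin_cases i
    · simp [shearMap_toFun_zero, jordanJ, jordanN, Matrix.mulVec, dotProduct, Fin.sum_univ_three]
    · simp [shearMap_toFun_one, polyFun, jordanJ, jordanN, Matrix.mulVec, dotProduct,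
        Fin.sum_univ_three]
    · simp [shearMap_toFun_two, polyFun, jordanJ, jordanN, Matrix.mulVec, dotProduct,
        Fin.sum_univ_three]
  simp only [Diffeomorph.coe_refl, id, hJ]
  set L := Matrix.toEuclideanCLM (n := Fin 3) (𝕜 := ℝ) jordanJ
  refine isBigO_of_coord fun i => ?_
  have hsm : ContDiff ℝ ∞ (fun ξ => f ξ - L ξ) := f.contDiff.sub L.contDiff
  have hsm' : ContDiff ℝ ∞ (fun ξ => (f ξ - L ξ) i) := contDiff_euclidean.1 hsm i
  refine VanishesToOrder.isBigO (k := 2) ⟨hsm', by simp [hfix], fun j =>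
    ⟨contDiff_partialDeriv hsm' j, ?_, fun l => contDiff_partialDeriv
      (contDiff_partialDeriv hsm' j) l⟩⟩
  have h1 : HasFDerivAt (fun ξ => f ξ - L ξ) (0 : E3 →L[ℝ] E3) 0 := by
    have h2 := (f.contDiff.differentiable (by simp) 0).hasFDerivAt.sub (L.hasFDerivAt (x := 0))
    rwa [hlin, sub_self] at h2
  have h3 := (hasFDerivAt_coord i (f 0 - L 0)).comp (0 : E3) h1
  have h4 : fderiv ℝ (fun ξ => (f ξ - L ξ) i) 0 = _ := h3.fderiv
  rw [partialDeriv, h4]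
  simp

theorem IsNormalizedBy.exists_succ {f : E3 ≃ₘ[ℝ] E3} (hvol : IsVolumePreserving f)
    (hfix : f 0 = 0) {d : ℕ} (hd : 1 ≤ d) {q : MvPolynomial (Fin 2) ℝ} {ψ : E3 ≃ₘ[ℝ] E3}
    (H : IsNormalizedBy f d q ψ) :
    ∃ q' ψ', IsNormalizedBy f (d + 1) q' ψ' ∧ (q' - q).IsHomogeneous (d + 1) := by
  have hψ0 : ψ 0 = 0 := by
    have := eq_zero_of_isBigO_pow_succ (k := 1) H.near
    simpa using this
  have hψs0 : ψ.symm 0 = 0 := by simpa [hψ0] using ψ.symm_apply_apply 0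
  have hψ1 := isBigO_one_of_contDiff ψ.contDiff hψ0
  have hψs1 := isBigO_one_of_contDiff ψ.symm.contDiff hψs0
  have hq := isBigO_polyFun_rename fun s hs => (H.degree_mem s hs).1
  set F : E3 ≃ₘ[ℝ] E3 := (ψ.symm.trans f).trans ψ with hFdef
  have hFv : IsVolumePreserving F := (H.volume.symm.trans hvol).trans H.volume
  have hF0 : F 0 = 0 := by simp [hFdef, hψs0, hfix, hψ0]
  have hFq : (fun ξ => F ξ - (shearMap q).toFun ξ) =O[𝓝 0] (fun ξ : E3 => ‖ξ‖ ^ (d + 1)) :=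
    (isBigO_comp H.conj hψs1).congr_left fun ξ => by simp [hFdef]
  obtain ⟨r, φ, hr, hφ, hφid, hφF⟩ := exists_normalization_step (by omega) hq hFv hF0 hFq
  refine ⟨q + r, ψ.trans φ, ⟨fun s hs => ?_, H.volume.trans hφ, ?_, ?_⟩, by simpa using hr⟩
  · by_cases h : s ∈ q.support
    · have := H.degree_mem s h
      omega
    · have hs' : s ∈ r.support := by
        rw [mem_support_iff, coeff_add, notMem_support_iff.1 h, zero_add] at hs
        exact mem_support_iff.2 hs
      have := hr.degree_eq_of_mem_support hs'
      omega
  · have h1 := (isBigO_comp hφid hψ1).trans (isBigO_norm_pow_of_le (by omega : 2 ≤ d + 1))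
    exact (h1.add H.near).congr_left fun ξ => by simp
  · exact (isBigO_comp hφF hψ1).congr_left fun ξ => by simp [hFdef]

/-- The successive normalizations fit together into one formal power series. -/
theorem exists_normalForm {f : E3 ≃ₘ[ℝ] E3} (hvol : IsVolumePreserving f) (hfix : f 0 = 0)
    (hlin : fderiv ℝ f 0 = Matrix.toEuclideanCLM (n := Fin 3) (𝕜 := ℝ) jordanJ) :
    ∃ p : MvPowerSeries (Fin 2) ℝ, 2 ≤ p.order ∧ ∀ d : ℕ, 1 ≤ d →
      ∃ ψ : E3 ≃ₘ[ℝ] E3, IsNormalizedBy f d (MvPowerSeries.truncTotal (d + 1) p) ψ := by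
  choose! Q Ψ hQ hQ' using fun (d : ℕ) (hd : 1 ≤ d) (q : MvPolynomial (Fin 2) ℝ)
    (ψ : E3 ≃ₘ[ℝ] E3) (H : IsNormalizedBy f d q ψ) => H.exists_succ hvol hfix hd
  let s : ℕ → MvPolynomial (Fin 2) ℝ × (E3 ≃ₘ[ℝ] E3) := fun n =>
    Nat.rec (0, Diffeomorph.refl _ E3 ∞) (fun n x => (Q (n + 1) x.1 x.2, Ψ (n + 1) x.1 x.2)) n
  have hs (n : ℕ) : IsNormalizedBy f (n + 1) (s n).1 (s n).2 := by
    induction n with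
    | zero => exact isNormalizedBy_one hfix hlin
    | succ n ih => exact hQ (n + 1) (by omega) _ _ ih
  have hstep (n : ℕ) : ((s (n + 1)).1 - (s n).1).IsHomogeneous (n + 2) :=
    hQ' (n + 1) (by omega) _ _ (hs n)
  -- the terms of degree at most `n + 1` are final from stage `n` on
  have hstable (α : Fin 2 →₀ ℕ) (n : ℕ) (hα : α.degree ≤ n + 1) (m : ℕ) (hm : n ≤ m) :
      coeff α (s m).1 = coeff α (s n).1 := by
    induction m, hm using Nat.le_induction with
    | base => rfl
    | succ m hm ih =>
      have h1 := (hstep m).coeff_eq_zero (d := α) (by omega)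
      rw [coeff_sub] at h1
      rw [← ih]
      exact sub_eq_zero.1 h1
  let p : MvPowerSeries (Fin 2) ℝ := fun α => coeff α (s α.degree).1
  have hp (α : Fin 2 →₀ ℕ) : MvPowerSeries.coeff α p = coeff α (s α.degree).1 := rfl
  refine ⟨p, ?_, fun d hd => ?_⟩
  · refine MvPowerSeries.nat_le_order (n := 2) fun α hα => ?_
    rw [hp]
    by_contra h
    have := ((hs _).degree_mem α (mem_support_iff.2 h)).1
    omega
  · obtain ⟨n, rfl⟩ : ∃ n, d = n + 1 := ⟨d - 1, by omega⟩
    refine ⟨(s n).2, ?_⟩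
    have : MvPowerSeries.truncTotal (n + 1 + 1) p = (s n).1 := by
      ext α
      rw [MvPowerSeries.coeff_truncTotal_eq_ite]
      split_ifs with hα
      · rw [hp]
        rcases le_total α.degree n with h | h
        · exact (hstable α α.degree (by omega) n h).symm
        · exact hstable α n (by omega) _ h
      · by_contra h
        have := ((hs n).degree_mem α (mem_support_iff.2 (Ne.symm h))).2
        omega
    rw [this]
    exact hs n

theorem theorem2 (f : E3 ≃ₘ[ℝ] E3) (hvol : IsVolumePreserving f) (hfix : f 0 = 0)
    (hlin : fderiv ℝ f 0 = Matrix.toEuclideanCLM (n := Fin 3) (𝕜 := ℝ) jordanJ) :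
    -- `f` has a formal normal form `g(ξ) = J (ξ + ê₃ p(x, y))`, attained at every order
    (∃ p : MvPowerSeries (Fin 2) ℝ, 2 ≤ p.order ∧
      ∀ d : ℕ, 1 ≤ d →
        ∃ ψ : E3 ≃ₘ[ℝ] E3, IsVolumePreserving ψ ∧ IsNearIdentity ψ ∧
          (fun ξ => ψ (f ξ) - (normalFormTrunc p d).toFun (ψ ξ))
            =O[𝓝 0] (fun ξ => ‖ξ‖ ^ (d + 1))) ∧
    -- every truncation of a map of this form is exactly volume-preserving and has a
    -- polynomial inverse of the same degree
    (∀ p : MvPowerSeries (Fin 2) ℝ, 2 ≤ p.order → ∀ d : ℕ, 1 ≤ d →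
      IsVolumePreserving (normalFormTrunc p d).toFun ∧
        ∃ Q : PolyMap,
          Function.LeftInverse Q.toFun (normalFormTrunc p d).toFun ∧
          Function.RightInverse Q.toFun (normalFormTrunc p d).toFun ∧
          Q.degree = (normalFormTrunc p d).degree) := by

  refine ⟨?_, fun p hp d hd => ?_⟩
  · obtain ⟨p, hp, H⟩ := exists_normalForm hvol hfix hlin
    refine ⟨p, hp, fun d hd => ?_⟩
    obtain ⟨ψ, hψ⟩ := H d hd
    exact ⟨ψ, hψ.volume, hψ.near, hψ.conj⟩
  · have hq : ∀ s ∈ (MvPowerSeries.truncTotal (d + 1) p).support, 2 ≤ s.degree := by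
      intro s hs
      by_contra h
      refine MvPolynomial.mem_support_iff.1 hs ?_
      rw [MvPowerSeries.coeff_truncTotal_eq_ite, MvPowerSeries.coeff_of_lt_order, ite_self]
      exact lt_of_lt_of_le (by exact_mod_cast not_le.1 h) hp
    exact ⟨isVolumePreserving_shearMap _, shearMapInv _, leftInverse_shearMapInv _,
      rightInverse_shearMapInv _, degree_shearMapInv hq⟩
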